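/- **Setting.** Let $V=\{x_1,\dots,x_n\}$. A $k$-clause is an ordered $k$-tuple of literals over $V$, and a formula $\Phi=(\Phi_1,\dots,\Phi_m)$ is an ordered $m$-tuple of $k$-clauses (repetitions are allowed in both); $\Phi_{ij}$ is the $j$th literal of $\Phi_i$ and $|\Phi_{ij}|$ its underlying variable. For $Z\subset V$, a clause is *$Z$-unique* if exactly one of its $k$ positions holds a positive literal from $V\setminus Z$ and no negative literal in it has its underlying variable in $Z$. A variable $x\in V\setminus Z$ is *$Z$-unsafe* if it occurs positively in a $Z$-unique clause of $\Phi$, and *$Z$-safe* otherwise. Let $\sigma_Z$ be the assignment that sets the variables in $Z$ to false and those in $V\setminus Z$ to true. Let $k_1=\lceil k/2\rceil$. *Phase 1 of Fix* on input $\Phi$: start with $Z=\emptyset$. For $i=1,\dots,m$ in this order: if all literals of $\Phi_i$ are negative and no variable of $\Phi_i$ lies in the current set $Z$, then, if there is $1\le j<k_1$ such that $|\Phi_{ij}|$ is $Z$-safe, add $|\Phi_{ij}|$ to $Z$ for the least such $j$; otherwise add $|\Phi_{i\,k_1}|$ to $Z$. **Proposition 3.1.** For every $0<\varepsilon<0.1$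 there is $k_0=k_0(\varepsilon)$ such that for every $k\ge k_0$ the following holds. Put $\omega=(1-\varepsilon)\ln k$ and $m=\lfloor(1-\varepsilon)2^kk^{-1}\ln(k)\,n\rfloor$, and let $\mathbf\Phi$ be uniformly distributed over the $(2n)^{km}$ formulas with $m$ $k$-clauses over $n$ variables. Then, with probability tending to $1$ as $n\to\infty$ (with $\varepsilon$ and $k$ fixed), the set $Z$ at the end of Phase 1 of Fix on $\mathbf\Phi$ satisfies all of the following: 1. $|Z|\le 4nk^{-1}\ln\omega$. 2. At most $(1+\varepsilon/3)\,\omega n$ of the clauses of $\mathbf\Phi$ are $Z$-unique. 3. At most $\exp(-k^{\varepsilon/8})\,n$ of the clauses of $\mathbf\Phi$ are unsatisfied under $\sigma_Z$. -/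

import Mathlib

open Filter Topology

namespace RandomKSAT

/-- Literals over the variables `x₁, …, xₙ` (indexed by `Fin n`): `(x, true)` is the positive
literal `x`, and `(x, false)` is the negative literal `x̄`. The underlying variable `|l|` is `l.1`. -/
abbrev Literal (n : ℕ) : Type := Fin n × Bool

/-- A `k`-clause is an ordered `k`-tuple of literals, repetitions allowed. -/
abbrev Clause (k n : ℕ) : Type := Fin k → Literal n

/-- A formula is an ordered `m`-tuple of `k`-clauses, repetitions allowed. -/
abbrev Formula (k n m : ℕ) : Type := Fin m → Clause k n

variable {k n m : ℕ}

/-- All literals of the clause are negative. -/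
def AllNegative (C : Clause k n) : Prop := ∀ j, (C j).2 = false

instance (C : Clause k n) : Decidable (AllNegative C) := by
  unfold AllNegative; infer_instance

/-- The clause contains (positively or negatively) a variable from `Z`. -/
def MeetsVars (Z : Finset (Fin n)) (C : Clause k n) : Prop := ∃ j, (C j).1 ∈ Z

instance (Z : Finset (Fin n)) (C : Clause k n) : Decidable (MeetsVars Z C) := by
  unfold MeetsVars; infer_instance

/-- The clause is `Z`-unique: exactly one of its `k` positions holds a positive literal from
`V \ Z`, and no negative literal in it has its underlying variable in `Z`. -/
def ZUnique (Z : Finset (Fin n)) (C : Clause k n) : Prop :=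
  (∃! j, (C j).2 = true ∧ (C j).1 ∉ Z) ∧ ∀ j, (C j).2 = false → (C j).1 ∉ Z

instance (Z : Finset (Fin n)) (C : Clause k n) : Decidable (ZUnique Z C) := by
  unfold ZUnique; unfold ExistsUnique; infer_instance

/-- The variable `x` of `V \ Z` is `Z`-unsafe: it occurs positively in a `Z`-unique clause. -/
def ZUnsafe (Φ : Formula k n m) (Z : Finset (Fin n)) (x : Fin n) : Prop :=
  x ∉ Z ∧ ∃ i, ZUnique Z (Φ i) ∧ ∃ j, Φ i j = (x, true)

instance (Φ : Formula k n m) (Z : Finset (Fin n)) (x : Fin n) : Decidable (ZUnsafe Φ Z x) := by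
  unfold ZUnsafe; infer_instance

/-- The variable `x` of `V \ Z` is `Z`-safe: it is not `Z`-unsafe. -/
def ZSafe (Φ : Formula k n m) (Z : Finset (Fin n)) (x : Fin n) : Prop :=
  x ∉ Z ∧ ¬ ZUnsafe Φ Z x

instance (Φ : Formula k n m) (Z : Finset (Fin n)) (x : Fin n) : Decidable (ZSafe Φ Z x) := by
  unfold ZSafe; infer_instance

/-- `k₁ = ⌈k / 2⌉` (natural-number division rounds down). -/
def k₁ (k : ℕ) : ℕ := (k + 1) / 2

theorem k₁_sub_one_lt (hk : 0 < k) : k₁ k - 1 < k := by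
  unfold k₁; omega

/-- The positions before position `k₁` (counted from `1`, so that `j : Fin k` is the position
`j + 1`) of the `i`-th clause in which the underlying variable is `Z`-safe. -/
def safePositions (Φ : Formula k n m) (Z : Finset (Fin n)) (i : Fin m) : Finset (Fin k) :=
  Finset.univ.filter fun j => (j : ℕ) + 1 < k₁ k ∧ ZSafe Φ Z (Φ i j).1

/-- The body of the loop of Phase 1 for the `i`-th clause, as an update of the current set `Z`:
if the clause is all-negative and contains no variable from `Z`, then the variable in the first
safe position before position `k₁` is added to `Z`, or, if there is no such position, the variable
in position `k₁` (which is the element `k₁ - 1` of `Fin k`). Clauses of length `k = 0` have no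
position; for them nothing is done. -/
def phase1Step (Φ : Formula k n m) (Z : Finset (Fin n)) (i : Fin m) : Finset (Fin n) :=
  if AllNegative (Φ i) ∧ ¬ MeetsVars Z (Φ i) then
    if h : (safePositions Φ Z i).Nonempty then
      insert (Φ i ((safePositions Φ Z i).min' h)).1 Z
    else if hk : 0 < k then
      insert (Φ i ⟨k₁ k - 1, k₁_sub_one_lt hk⟩).1 Z
    else Z
  else Z

/-- The set `Z` at the end of Phase 1: start from `∅` and treat the clauses in order. -/
def phase1 (Φ : Formula k n m) : Finset (Fin n) :=
  (List.finRange m).foldl (phase1Step Φ) ∅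

/-- The assignment `σ_Z`: false on `Z`, true on `V \ Z`. -/
def sigma (Z : Finset (Fin n)) (x : Fin n) : Bool := decide (x ∉ Z)

/-- The clause is satisfied under the assignment `σ`: one of its literals is true. -/
def Satisfies (σ : Fin n → Bool) (C : Clause k n) : Prop := ∃ j, σ (C j).1 = (C j).2

instance (σ : Fin n → Bool) (C : Clause k n) : Decidable (Satisfies σ C) := by
  unfold Satisfies; infer_instance

/-- The number of `Z`-unique clauses of the formula (indices of clauses are counted). -/
def numZUnique (Φ : Formula k n m) (Z : Finset (Fin n)) : ℕ :=
  (Finset.univ.filter fun i => ZUnique Z (Φ i)).card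

/-- The number of clauses of the formula that are not satisfied under `σ`. -/
def numUnsat (Φ : Formula k n m) (σ : Fin n → Bool) : ℕ :=
  (Finset.univ.filter fun i => ¬ Satisfies σ (Φ i)).card

/-- `ω = (1 - ε) ln k`. -/
noncomputable def omega (ε : ℝ) (k : ℕ) : ℝ := (1 - ε) * Real.log k

/-- The number of clauses `m = ⌊(1 - ε) 2ᵏ k⁻¹ ln k · n⌋`. -/
noncomputable def numClauses (ε : ℝ) (k n : ℕ) : ℕ :=
  ⌊(1 - ε) * 2 ^ k * (k : ℝ)⁻¹ * Real.log k * n⌋₊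

/-- The uniform probability measure on the formulas with `m` clauses of length `k` over `n`
variables. -/
noncomputable def uniformFormula (k n m : ℕ) : MeasureTheory.Measure (Formula k n m) :=
  ProbabilityTheory.uniformOn Set.univ

end RandomKSAT

/-!
Which clauses are `Z`-unique, and hence which variables are `Z`-safe, does not depend on the
all-negative clauses. Redrawing the variables of the all-negative clauses preserves the uniform
distribution, so conditionally on everything else Phase 1 is a Markov chain driven by independent
uniform vectors of variables, and exponential potentials of `Z` control it.

* `|Z|` grows only if a fresh all-negative clause avoids `Z`. Once `|Z| ≥ τ n / 2`, where
  `τ = 4 k⁻¹ ln ω`, this has probability at most `exp (-k τ / 2) = ω⁻²`.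
* There are few sets `Z` of size at most `τ n`, so a union bound over all of them shows that each
  leaves at most `(1 + ε / 3) ω n` unique clauses (a Chernoff bound) and at least
  `k ^ (-1 + ε / 2) n` safe variables (occupancy of the variables by the unique clauses).
* Every all-negative clause ends up satisfied, and only `O(1)` clauses have a repeated variable.
  Any other clause becomes unsatisfied only when its last true variable, which is then unsafe, is
  added to `Z`. This needs a vector whose first `k₁ - 1` variables are all unsafe, and by the
  previous point the probability of that is at most about `exp (-k ^ (ε / 2) / 2)`.
-/

namespace RandomKSAT

section Uniform

open MeasureTheory ProbabilityTheory
open scoped BigOperators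

variable {α β ι : Type*}

/-- The probability of an event under the uniform distribution on a finite type, as a real
number. -/
noncomputable abbrev prob [MeasurableSpace α] (S : Set α) : ℝ :=
  (uniformOn (Set.univ : Set α)).real S

theorem prob_le_sum [MeasurableSpace α] {S : Set α} (s : Finset ι) (T : ι → Set α)
    (h : ∀ a ∈ S, ∃ z ∈ s, a ∈ T z) : prob S ≤ ∑ z ∈ s, prob (T z) :=
  (measureReal_mono (fun a ha => by simpa using h a ha) (measure_ne_top _ _)).trans
    (measureReal_biUnion_finset_le s T)

section Basic

variable [Fintype α] [MeasurableSpace α] [MeasurableSingletonClass α]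

theorem integral_uniformOn_univ (F : α → ℝ) : ∫ a, F a ∂uniformOn Set.univ = 𝔼 a, F a := by
  rw [integral_fintype .of_finite, Fintype.expect_eq_sum_div_card, Finset.sum_div]
  refine Finset.sum_congr rfl fun a _ => ?_
  simp [measureReal_def, uniformOn_univ, div_eq_inv_mul]

theorem prob_eq_expect_indicator (S : Set α) : prob S = 𝔼 a, S.indicator 1 a := by
  rw [← integral_uniformOn_univ, integral_indicator_one S.toFinite.measurableSet]

theorem prob_setOf_eq_expect (P : α → Prop) [DecidablePred P] :
    prob {a | P a} = 𝔼 a, if P a then 1 else 0 := by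
  simp only [prob_eq_expect_indicator, Set.indicator_apply, Pi.one_apply, Set.mem_ofPred_eq]

theorem prob_le_expect_div {S : Set α} {F : α → ℝ} {t : ℝ} (ht : 0 < t) (hF : ∀ a, 0 ≤ F a)
    (hS : ∀ a ∈ S, t ≤ F a) : prob S ≤ (𝔼 a, F a) / t := by
  rw [le_div_iff₀' ht, ← integral_uniformOn_univ]
  calc t * prob S ≤ t * prob {a | t ≤ F a} :=
        mul_le_mul_of_nonneg_left (measureReal_mono hS) ht.le
    _ ≤ _ := mul_meas_ge_le_integral_of_nonneg (.of_forall hF) .of_finite t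

end Basic

section Product

theorem prob_forall_mem_finset [Finite ι] [Finite β] [Nonempty β] [MeasurableSpace β]
    [MeasurableSingletonClass β] (s : Finset ι) (S : ι → Set β) :
    prob {x : ι → β | ∀ i ∈ s, x i ∈ S i} = ∏ i ∈ s, prob (S i) := by
  classical
  have := Fintype.ofFinite ι
  have h : {x : ι → β | ∀ i ∈ s, x i ∈ S i} =
      Set.univ.pi fun i => if i ∈ s then S i else Set.univ := by
    ext x
    simp only [Set.mem_ofPred_eq, Set.mem_univ_pi]
    exact forall_congr' fun i => by split_ifs with hi <;> simp [hi]
  rw [h, prob, ← Set.pi_univ, uniformOn_pi, measureReal_def, Measure.pi_pi, ENNReal.toReal_prod]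
  refine (Finset.prod_congr rfl fun i _ => ?_).trans (Fintype.prod_ite_mem s _)
  split_ifs <;> simp [measureReal_def]

theorem prob_eval_mem [Finite ι] [Finite β] [Nonempty β] [MeasurableSpace β]
    [MeasurableSingletonClass β] (i : ι) (S : Set β) : prob {x : ι → β | x i ∈ S} = prob S := by
  simpa using prob_forall_mem_finset {i} fun _ => S

theorem expect_pi_prod [Fintype ι] [Fintype β] [DecidableEq ι] (f : ι → β → ℝ) :
    𝔼 y : ι → β, ∏ i, f i (y i) = ∏ i, 𝔼 b, f i b := by
  simp only [Fintype.expect_eq_sum_div_card, Finset.prod_div_distrib, Finset.prod_univ_sum,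
    Fintype.piFinset_univ, Fintype.card_pi, Nat.cast_prod]

theorem chernoff_card_filter [Fintype ι] [Finite β] [Nonempty β]
    [MeasurableSpace β] [MeasurableSingletonClass β] (P : β → Prop) [DecidablePred P]
    {l : ℝ} (hl : 0 ≤ l) (t : ℝ) :
    prob {x : ι → β | t < (Finset.univ.filter fun i => P (x i)).card} ≤
      Real.exp (Fintype.card ι * prob {b | P b} * (Real.exp l - 1) - l * t) := by
  classical
  have := Fintype.ofFinite β
  have hexp : ∀ x : ι → β, Real.exp (l * (Finset.univ.filter fun i => P (x i)).card) =
      ∏ i, (1 + (Real.exp l - 1) * if P (x i) then (1 : ℝ) else 0) := fun x => by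
    rw [mul_comm, Real.exp_nat_mul, ← Finset.prod_const, Finset.prod_filter]
    exact Finset.prod_congr rfl fun i _ => by split_ifs <;> ring
  have hmgf : 𝔼 x : ι → β, Real.exp (l * (Finset.univ.filter fun i => P (x i)).card) ≤
      Real.exp (Fintype.card ι * prob {b | P b} * (Real.exp l - 1)) := by
    simp only [hexp]
    rw [expect_pi_prod fun _ b => 1 + (Real.exp l - 1) * if P b then (1 : ℝ) else 0]
    rw [Finset.prod_const, Finset.expect_add_distrib, ← Finset.mul_expect, Fintype.expect_const,
      ← prob_setOf_eq_expect, Finset.card_univ, mul_assoc, Real.exp_nat_mul]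
    have := sub_nonneg.2 (Real.one_le_exp hl)
    gcongr
    linarith [Real.add_one_le_exp (prob {b | P b} * (Real.exp l - 1))]
  rw [Real.exp_sub]
  refine (prob_le_expect_div (Real.exp_pos (l * t)) (fun x => (Real.exp_pos _).le)
    fun x hx => ?_).trans (div_le_div_of_nonneg_right hmgf (Real.exp_pos _).le)
  exact Real.exp_le_exp.2 (mul_le_mul_of_nonneg_left (le_of_lt hx) hl)

end Product

section Sequences

variable [Fintype α] [Fintype β]

theorem expect_fin_cons {m : ℕ} (F : (Fin (m + 1) → β) → ℝ) :
    𝔼 y, F y = 𝔼 b, 𝔼 y : Fin m → β, F (Fin.cons b y) := by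
  rw [← Finset.expect_product', Finset.univ_product_univ]
  exact (Fintype.expect_equiv (Fin.consEquiv fun _ => β) _ _ fun _ => rfl).symm

theorem expect_foldl_le {σ : Type*} {m : ℕ} (g : Fin m → σ → β → σ) {a : Fin m → ℝ}
    (ha : ∀ i, 0 ≤ a i) {W : σ → ℝ} (h : ∀ i s, 𝔼 b, W (g i s b) ≤ a i * W s) (s₀ : σ) :
    𝔼 y : Fin m → β, W ((List.finRange m).foldl (fun s i => g i s (y i)) s₀) ≤
      (∏ i, a i) * W s₀ := by
  induction m generalizing s₀ with
  | zero => simp [Finset.expect_const]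
  | succ m ih =>
    rw [expect_fin_cons, Fin.prod_univ_succ]
    simp only [List.finRange_succ, List.foldl_cons, List.foldl_map, Fin.cons_zero, Fin.cons_succ]
    calc _ ≤ 𝔼 b, (∏ i : Fin m, a i.succ) * W (g 0 s₀ b) :=
          Finset.expect_le_expect fun b _ =>
            ih (fun i => g i.succ) (fun i => ha _) (fun i s => h _ s) _
      _ ≤ (∏ i : Fin m, a i.succ) * (a 0 * W s₀) := by
          rw [← Finset.mul_expect]
          exact mul_le_mul_of_nonneg_left (h 0 s₀) (Finset.prod_nonneg fun i _ => ha _)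
      _ = _ := by ring

theorem expect_pi_map₂ {m : ℕ} {r : α → β → α}
    (hr : ∀ F : α → ℝ, 𝔼 a, 𝔼 b, F (r a b) = 𝔼 a, F a) (F : (Fin m → α) → ℝ) :
    𝔼 x : Fin m → α, 𝔼 y : Fin m → β, F (fun i => r (x i) (y i)) = 𝔼 x, F x := by
  induction m with
  | zero =>
    simp only [Finset.univ_unique, Finset.expect_singleton]
    exact congrArg F (Subsingleton.elim _ _)
  | succ m ih =>
    have hcons : ∀ (a : α) (b : β) (x : Fin m → α) (y : Fin m → β),
        (fun i => r ((Fin.cons a x : Fin (m + 1) → α) i) ((Fin.cons b y : Fin (m + 1) → β) i)) =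
          Fin.cons (r a b) fun i => r (x i) (y i) := by
      intro a b x y
      ext i
      refine Fin.cases ?_ (fun i => ?_) i <;> simp
    rw [expect_fin_cons, expect_fin_cons F, ← hr fun a => 𝔼 x : Fin m → α, F (Fin.cons a x)]
    refine Finset.expect_congr rfl fun a _ => ?_
    simp only [expect_fin_cons (β := β), hcons]
    rw [Finset.expect_comm]
    exact Finset.expect_congr rfl fun b _ => ih fun x => F (Fin.cons (r a b) x)

end Sequences

end Uniform

section Clauses

open scoped BigOperators

variable {k n m : ℕ}

/-- The variable `x` of `V \ Z` occurs positively in the clause `C`, and every literal of `C`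
except this one occurrence is false under `σ_Z`. Thus `C` is `Z`-unique, and `x` is the variable
of its only true literal. -/
def UniqueAt (Z : Finset (Fin n)) (C : Clause k n) (x : Fin n) : Prop :=
  x ∉ Z ∧ ∃ j, C j = (x, true) ∧ ∀ i ≠ j, sigma Z (C i).1 ≠ (C i).2

instance (Z : Finset (Fin n)) (C : Clause k n) (x : Fin n) : Decidable (UniqueAt Z C x) := by
  unfold UniqueAt; infer_instance

theorem UniqueAt.eq {Z : Finset (Fin n)} {C : Clause k n} {x y : Fin n}
    (hx : UniqueAt Z C x) (hy : UniqueAt Z C y) : x = y := by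
  obtain ⟨-, j, hj, hj'⟩ := hx
  obtain ⟨hyZ, i, hi, -⟩ := hy
  have hij : i = j := by_contra fun h => hj' i h (by simp [hi, sigma, hyZ])
  exact congrArg Prod.fst (hj.symm.trans (hij ▸ hi))

theorem uniqueAt_iff {Z : Finset (Fin n)} {C : Clause k n} {x : Fin n} :
    UniqueAt Z C x ↔ x ∉ Z ∧ ZUnique Z C ∧ ∃ j, C j = (x, true) := by
  have hlit : ∀ j, sigma Z (C j).1 ≠ (C j).2 ↔
      ((C j).2 = true → (C j).1 ∈ Z) ∧ ((C j).2 = false → (C j).1 ∉ Z) := fun j => by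
    cases (C j).2 <;> simp [sigma]
  refine and_congr_right fun hx => ⟨fun ⟨j, hj, hf⟩ => ⟨⟨⟨j, by simp [hj, hx], fun i hi => ?_⟩,
    fun i hi => ?_⟩, j, hj⟩, fun ⟨⟨⟨j₀, _, huniq⟩, hneg⟩, j, hj⟩ => ⟨j, hj, fun i hij => ?_⟩⟩
  · by_contra hij
    exact hi.2 (((hlit i).1 (hf i hij)).1 hi.1)
  · exact ((hlit i).1 (hf i fun hij => by simp [hij, hj] at hi)).2 hi
  · refine (hlit i).2 ⟨fun hi => by_contra fun hiZ => hij ?_, hneg i⟩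
    exact (huniq i ⟨hi, hiZ⟩).trans (huniq j (by simp [hj, hx])).symm

theorem zUnique_iff_exists_uniqueAt {Z : Finset (Fin n)} {C : Clause k n} :
    ZUnique Z C ↔ ∃ x, UniqueAt Z C x := by
  refine ⟨fun h => ?_, fun ⟨x, hx⟩ => (uniqueAt_iff.1 hx).2.1⟩
  obtain ⟨j, ⟨hpos, hj⟩, -⟩ := h.1
  exact ⟨(C j).1, uniqueAt_iff.2 ⟨hj, h, j, Prod.ext rfl hpos⟩⟩

theorem zSafe_iff {Φ : Formula k n m} {Z : Finset (Fin n)} {x : Fin n} :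
    ZSafe Φ Z x ↔ x ∉ Z ∧ ∀ i, ¬ UniqueAt Z (Φ i) x := by
  refine and_congr_right fun hx => ?_
  simp only [ZUnsafe, uniqueAt_iff, hx, not_false_eq_true, true_and, not_exists]

/-- The variables of the clause are pairwise distinct. Repetitions are rare, but they must be
excluded where Phase 1 is to be compared with independent choices of variables. -/
def DistinctVars (C : Clause k n) : Prop := Function.Injective fun j => (C j).1

instance (C : Clause k n) : Decidable (DistinctVars C) := by
  unfold DistinctVars Function.Injective; infer_instance

section Literals

variable {α β : Type*} [MeasurableSpace α] [MeasurableSingletonClass α] [MeasurableSpace β]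
  [MeasurableSingletonClass β]

theorem prob_singleton [Fintype α] (a : α) : prob {a} = 1 / Fintype.card α := by
  classical
  simpa [Fintype.expect_eq_sum_div_card] using prob_setOf_eq_expect (· = a)

theorem prob_graph [Finite α] [Nonempty α] [Fintype β] (f : α → β) :
    prob {p : α × β | p.2 = f p.1} = 1 / Fintype.card β := by
  classical
  have := Fintype.ofFinite α
  rw [prob_setOf_eq_expect, ← Finset.univ_product_univ, Finset.expect_product]
  simp [Finset.expect, NNRat.smul_def]

theorem prob_fst_eq [Fintype α] [Finite β] [Nonempty β] (a : α) :
    prob {p : α × β | p.1 = a} = 1 / Fintype.card α := by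
  classical
  have := Fintype.ofFinite β
  rw [prob_setOf_eq_expect, ← Finset.univ_product_univ,
    Finset.expect_product' _ _ fun b _ => if b = a then 1 else 0]
  simp [NNRat.smul_def]

end Literals

theorem prob_uniqueAt_le (Z : Finset (Fin n)) (x : Fin n) :
    prob {C : Clause k n | UniqueAt Z C x} ≤ k / 2 ^ k / n := by
  have : Nonempty (Fin n) := ⟨x⟩
  let S (j i : Fin k) : Set (Literal n) :=
    if i = j then {(x, true)} else {l | l.2 = !sigma Z l.1}
  have hS : ∀ j, ∏ i, prob (S j i) = 1 / 2 ^ k / n := fun j => by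
    have h : ∀ i, prob (S j i) = 1 / 2 * if i = j then (1 / n : ℝ) else 1 := fun i => by
      simp only [S]
      split_ifs
      · rw [prob_singleton]; simp [mul_comm]
      · rw [prob_graph fun y => !sigma Z y]; simp
    simp only [h, Finset.prod_mul_distrib, Finset.prod_ite_eq', Finset.mem_univ, if_true,
      Finset.prod_const, Finset.card_univ, Fintype.card_fin, one_div_pow]
    ring
  calc prob {C : Clause k n | UniqueAt Z C x}
      ≤ ∑ j, prob {C : Clause k n | ∀ i ∈ Finset.univ, C i ∈ S j i} := by
        refine prob_le_sum _ _ fun C ⟨_, j, hj, hf⟩ => ⟨j, Finset.mem_univ j, fun i _ => ?_⟩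
        by_cases hij : i = j
        · simp [S, hij, hj]
        · simpa [S, hij, Bool.eq_not] using (hf i hij).symm
    _ = k / 2 ^ k / n := by
        simp only [prob_forall_mem_finset, hS, Finset.sum_const, Finset.card_univ,
          Fintype.card_fin, nsmul_eq_mul]
        ring

theorem prob_zUnique_le [NeZero n] (Z : Finset (Fin n)) :
    prob {C : Clause k n | ZUnique Z C} ≤ k / 2 ^ k := by
  calc prob {C : Clause k n | ZUnique Z C}
      ≤ ∑ x, prob {C : Clause k n | UniqueAt Z C x} :=
        prob_le_sum _ _ fun C hC => by simpa using zUnique_iff_exists_uniqueAt.1 hC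
    _ ≤ ∑ _x : Fin n, (k / 2 ^ k / n : ℝ) := Finset.sum_le_sum fun x _ => prob_uniqueAt_le Z x
    _ = k / 2 ^ k := by
        rw [Finset.sum_const, Finset.card_univ, Fintype.card_fin, nsmul_eq_mul,
          mul_div_cancel₀ _ (NeZero.ne _)]

theorem prob_allNegative [NeZero n] : prob {C : Clause k n | AllNegative C} = 1 / 2 ^ k := by
  have h := prob_forall_mem_finset (Finset.univ : Finset (Fin k))
    fun _ => {l : Literal n | l.2 = false}
  rw [prob_graph fun _ => false] at h
  simpa [AllNegative] using h

theorem prob_occurs_le (x : Fin n) :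
    prob {C : Clause k n | ∃ j, C j = (x, true)} ≤ k / 2 / n := by
  have : Nonempty (Fin n) := ⟨x⟩
  calc prob {C : Clause k n | ∃ j, C j = (x, true)}
      ≤ ∑ j, prob {C : Clause k n | C j ∈ ({(x, true)} : Set (Literal n))} :=
        prob_le_sum _ _ fun C hC => by simpa using hC
    _ = k / 2 / n := by
        simp only [prob_eval_mem, prob_singleton, Finset.sum_const, Finset.card_univ,
          Fintype.card_prod, Fintype.card_fin, Fintype.card_bool, Nat.cast_mul, Nat.cast_ofNat,
          nsmul_eq_mul]
        ring

theorem prob_var_eq_var_le [NeZero n] {i j : Fin k} (hij : i ≠ j) :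
    prob {C : Clause k n | (C i).1 = (C j).1} ≤ 1 / n := by
  calc prob {C : Clause k n | (C i).1 = (C j).1}
      ≤ ∑ x : Fin n, prob {C : Clause k n | ∀ p ∈ ({i, j} : Finset (Fin k)),
          C p ∈ {l : Literal n | l.1 = x}} :=
        prob_le_sum _ _ fun C hC => ⟨(C i).1, by simpa using Eq.symm hC⟩
    _ = ∑ _x : Fin n, (1 / n : ℝ) ^ 2 := by
        simp only [prob_forall_mem_finset, prob_fst_eq, Finset.prod_const, Finset.card_pair hij,
          Fintype.card_fin]
    _ = 1 / n := by
        have : (n : ℝ) ≠ 0 := NeZero.ne _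
        simp only [Finset.sum_const, Finset.card_univ, Fintype.card_fin, nsmul_eq_mul]
        field_simp

theorem prob_not_distinctVars_le [NeZero n] :
    prob {C : Clause k n | ¬ DistinctVars C} ≤ k ^ 2 / n := by
  calc prob {C : Clause k n | ¬ DistinctVars C}
      ≤ ∑ p ∈ (Finset.univ : Finset (Fin k)).offDiag,
          prob {C : Clause k n | (C p.1).1 = (C p.2).1} :=
        prob_le_sum _ _ fun C hC => by
          simpa [DistinctVars, Function.Injective, and_comm] using hC
    _ ≤ ∑ _p ∈ (Finset.univ : Finset (Fin k)).offDiag, (1 / n : ℝ) :=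
        Finset.sum_le_sum fun p hp => prob_var_eq_var_le (Finset.mem_offDiag.1 hp).2.2
    _ ≤ ∑ _p : Fin k × Fin k, (1 / n : ℝ) :=
        Finset.sum_le_sum_of_subset_of_nonneg (Finset.subset_univ _) fun _ _ _ => by positivity
    _ = k ^ 2 / n := by
        simp only [Finset.sum_const, Finset.card_univ, Fintype.card_prod, Fintype.card_fin,
          nsmul_eq_mul, Nat.cast_mul]
        ring

end Clauses

section Occupancy

open scoped BigOperators

variable {α β : Type*} [Nonempty α] [MeasurableSpace α] [MeasurableSingletonClass α]
  (H : α → β → Prop) [∀ a b, Decidable (H a b)] {p w : ℝ} (E : Finset β)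

theorem expect_pow_card_not_le [Fintype α] (hw₀ : 0 ≤ w) (hw₁ : w ≤ 1) (hp₀ : 0 ≤ p)
    (hH : ∀ a, ∀ b ∈ E, ∀ c ∈ E, H a b → H a c → b = c)
    (hp : ∀ b ∈ E, prob {a | H a b} ≤ p) :
    𝔼 a, (1 - w) ^ (E.filter fun b => ¬ H a b).card ≤ (1 - w * (1 - p)) ^ E.card := by
  rcases E.eq_empty_or_nonempty with rfl | hE
  · simp
  obtain ⟨e, he⟩ : ∃ e, e + 1 = E.card := ⟨E.card - 1, Nat.sub_add_cancel hE.card_pos⟩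
  have hpow : ∀ a, (1 - w) ^ (E.filter fun b => ¬ H a b).card =
      (1 - w) ^ e * ((1 - w) + w * ∑ b ∈ E, if H a b then 1 else 0) := fun a => by
    have hcard := Finset.card_filter_add_card_filter_not (s := E) (fun b => H a b)
    have hle : (E.filter fun b => H a b).card ≤ 1 := Finset.card_le_one.2 fun b hb c hc =>
      hH a b (Finset.mem_filter.1 hb).1 c (Finset.mem_filter.1 hc).1
        (Finset.mem_filter.1 hb).2 (Finset.mem_filter.1 hc).2
    rw [Finset.sum_boole]
    obtain h | h : _ = 0 ∨ _ = 1 := Nat.le_one_iff_eq_zero_or_eq_one.1 hle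
    · rw [show (E.filter fun b => ¬ H a b).card = e + 1 by omega, h, pow_succ]
      simp
    · rw [show (E.filter fun b => ¬ H a b).card = e by omega, h]
      simp
  calc 𝔼 a, (1 - w) ^ (E.filter fun b => ¬ H a b).card
      = (1 - w) ^ e * ((1 - w) + w * ∑ b ∈ E, prob {a | H a b}) := by
        simp only [hpow, prob_setOf_eq_expect, ← Finset.expect_sum_comm]
        rw [← Finset.mul_expect, Finset.expect_add_distrib, Fintype.expect_const,
          ← Finset.mul_expect]
    _ ≤ (1 - w) ^ e * ((1 - w) + w * (E.card * p)) := by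
        have : 0 ≤ (1 - w) ^ e := pow_nonneg (by linarith) e
        gcongr
        simpa using Finset.sum_le_sum hp
    _ ≤ (1 - w * (1 - p)) ^ E.card := by
        have h := pow_add_mul_le_add_pow (a := 1 - w) (b := w * p) (by linarith) (by nlinarith)
          (e + 1)
        rw [← he, show 1 - w * (1 - p) = 1 - w + w * p by ring]
        refine le_trans (le_of_eq ?_) h
        rw [Nat.add_sub_cancel]
        ring

/-- Exponential moment of the number of bins in `E` that stay empty when `m` independent balls are
thrown, each of which hits at most one bin, and any given bin with probability at most `p`. -/
theorem expect_pow_card_unhit_le [Fintype α] {m : ℕ} (hw₀ : 0 ≤ w) (hw₁ : w ≤ 1) (hp₀ : 0 ≤ p)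
    (hp₁ : p ≤ 1) (hH : ∀ a, ∀ b ∈ E, ∀ c ∈ E, H a b → H a c → b = c)
    (hp : ∀ b ∈ E, prob {a | H a b} ≤ p) :
    𝔼 x : Fin m → α, (1 - w) ^ (E.filter fun b => ∀ i, ¬ H (x i) b).card ≤
      (1 - w * (1 - p) ^ m) ^ E.card := by
  induction m generalizing E with
  | zero => simp
  | succ m ih =>
    have hq₀ : 0 ≤ (1 - p) ^ m := pow_nonneg (by linarith) m
    have hq₁ : (1 - p) ^ m ≤ 1 := pow_le_one₀ (by linarith) (by linarith)
    calc 𝔼 x : Fin (m + 1) → α, (1 - w) ^ (E.filter fun b => ∀ i, ¬ H (x i) b).card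
        = 𝔼 a, 𝔼 x : Fin m → α,
            (1 - w) ^ ((E.filter fun b => ¬ H a b).filter fun b => ∀ i, ¬ H (x i) b).card := by
          simp only [expect_fin_cons, Finset.filter_filter, Fin.forall_fin_succ, Fin.cons_zero,
            Fin.cons_succ]
      _ ≤ 𝔼 a, (1 - w * (1 - p) ^ m) ^ (E.filter fun b => ¬ H a b).card :=
          Finset.expect_le_expect fun a _ => ih _
            (fun a b hb c hc => hH a b (Finset.mem_filter.1 hb).1 c (Finset.mem_filter.1 hc).1)
            fun b hb => hp b (Finset.mem_filter.1 hb).1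
      _ ≤ (1 - w * (1 - p) ^ m * (1 - p)) ^ E.card :=
          expect_pow_card_not_le H E (by positivity) (mul_le_one₀ hw₁ hq₀ hq₁) hp₀ hH hp
      _ = (1 - w * (1 - p) ^ (m + 1)) ^ E.card := by rw [pow_succ, mul_assoc]

theorem prob_card_unhit_lt_le [Finite α] {m : ℕ} (hp₀ : 0 ≤ p) (hp₁ : p ≤ 1)
    (hH : ∀ a, ∀ b ∈ E, ∀ c ∈ E, H a b → H a c → b = c)
    (hp : ∀ b ∈ E, prob {a | H a b} ≤ p) (s : ℝ) :
    prob {x : Fin m → α | ((E.filter fun b => ∀ i, ¬ H (x i) b).card : ℝ) < s} ≤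
      Real.exp (s - (1 - p) ^ m * E.card / 2) := by
  have := Fintype.ofFinite α
  have hexp : Real.exp (-1) ≤ 1 - 1 / 2 := by
    rw [Real.exp_neg, inv_le_comm₀ (Real.exp_pos _) (by norm_num)]
    linarith [Real.add_one_le_exp (1 : ℝ)]
  have hq₁ : (1 - p) ^ m ≤ 1 := pow_le_one₀ (by linarith) (by linarith)
  calc prob {x : Fin m → α | ((E.filter fun b => ∀ i, ¬ H (x i) b).card : ℝ) < s}
      ≤ (𝔼 x : Fin m → α, (1 - 1 / 2 : ℝ) ^ (E.filter fun b => ∀ i, ¬ H (x i) b).card) /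
          Real.exp (-s) := by
        refine prob_le_expect_div (Real.exp_pos _) (fun x => by positivity) fun x hx => ?_
        refine le_trans ?_ (pow_le_pow_left₀ (Real.exp_pos _).le hexp _)
        rw [← Real.exp_nat_mul, mul_neg_one]
        exact Real.exp_le_exp.2 (neg_le_neg (le_of_lt hx))
    _ ≤ Real.exp (-((1 - p) ^ m / 2)) ^ E.card / Real.exp (-s) := by
        refine div_le_div_of_nonneg_right ((expect_pow_card_unhit_le H E (by norm_num)
          (by norm_num) hp₀ hp₁ hH hp).trans ?_) (Real.exp_pos _).le
        refine pow_le_pow_left₀ (by linarith) ?_ _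
        linarith [Real.add_one_le_exp (-((1 - p) ^ m / 2))]
    _ = Real.exp (s - (1 - p) ^ m * E.card / 2) := by
        rw [← Real.exp_nat_mul, ← Real.exp_sub]
        ring_nf

end Occupancy

theorem card_filter_card_le {β : Type*} [Fintype β] (t : ℝ) {y : ℝ} (hy₀ : 0 < y) (hy₁ : y ≤ 1) :
    ((Finset.univ.filter fun Z : Finset β => (Z.card : ℝ) ≤ t).card : ℝ) ≤
      Real.exp (Fintype.card β * y - t * Real.log y) := by
  have hone : ∀ Z : Finset β, (Z.card : ℝ) ≤ t →
      1 ≤ Real.exp (-(t * Real.log y)) * y ^ Z.card := fun Z hZ => by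
    rw [← Real.exp_log hy₀, ← Real.exp_nat_mul, Real.exp_log hy₀, ← Real.exp_add]
    exact Real.one_le_exp (by nlinarith [Real.log_nonpos hy₀.le hy₁])
  calc ((Finset.univ.filter fun Z : Finset β => (Z.card : ℝ) ≤ t).card : ℝ)
      ≤ ∑ Z : Finset β, Real.exp (-(t * Real.log y)) * y ^ Z.card := by
        rw [← Finset.sum_boole]
        refine Finset.sum_le_sum fun Z _ => ?_
        split_ifs with hZ
        exacts [hone Z hZ, by positivity]
    _ = Real.exp (-(t * Real.log y)) * (y + 1) ^ Fintype.card β := by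
        rw [← Finset.mul_sum, ← Fintype.sum_pow_mul_eq_add_pow]
        simp only [one_pow, mul_one]
    _ ≤ Real.exp (-(t * Real.log y)) * Real.exp y ^ Fintype.card β := by
        gcongr
        exact Real.add_one_le_exp y
    _ = Real.exp (Fintype.card β * y - t * Real.log y) := by
        rw [← Real.exp_nat_mul, ← Real.exp_add]
        ring_nf

section Resampling

open scoped BigOperators

variable {k n m : ℕ} {Φ : Formula k n m} {C : Clause k n} {Z : Finset (Fin n)}
  {v : Fin k → Fin n}

/-- Replace the variables of an all-negative clause by `v`, and keep any other clause. -/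
def resampleClause (C : Clause k n) (v : Fin k → Fin n) : Clause k n :=
  if AllNegative C then fun j => (v j, false) else C

/-- Replace the variables of the all-negative clauses of a formula by those given by `y`. -/
def resample (Φ : Formula k n m) (y : Fin m → Fin k → Fin n) : Formula k n m :=
  fun i => resampleClause (Φ i) (y i)

theorem expect_resampleClause [NeZero n] (F : Clause k n → ℝ) :
    𝔼 C, 𝔼 v, F (resampleClause C v) = 𝔼 C, F C := by
  have hsplit : ∀ G : Clause k n → ℝ, 𝔼 C, G C =
      𝔼 s : Fin k → Bool, 𝔼 v : Fin k → Fin n, G fun j => (v j, s j) := fun G => by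
    rw [Finset.expect_comm, ← Finset.expect_product', Finset.univ_product_univ]
    exact Fintype.expect_equiv (Equiv.arrowProdEquivProdArrow _ _ _) _ _ fun _ => rfl
  rw [hsplit, hsplit F]
  refine Finset.expect_congr rfl fun s _ => ?_
  by_cases hs : ∀ j, s j = false
  · simp only [resampleClause, AllNegative, hs, implies_true, if_true]
    exact Fintype.expect_const _
  · simp only [resampleClause, AllNegative, hs, if_false]
    exact Finset.expect_congr rfl fun v _ => Fintype.expect_const _

theorem prob_le_of_resample [NeZero n] {G B : Set (Formula k n m)} {r : ℝ} (hr : 0 ≤ r)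
    (h : ∀ Φ ∈ G, prob {y | resample Φ y ∈ B} ≤ r) : prob B ≤ prob Gᶜ + r := by
  calc prob B = 𝔼 Φ : Formula k n m, prob {y | resample Φ y ∈ B} := by
        rw [prob_eq_expect_indicator, ← expect_pi_map₂ expect_resampleClause]
        refine Finset.expect_congr rfl fun Φ _ => ?_
        rw [prob_eq_expect_indicator]
        rfl
    _ ≤ 𝔼 Φ : Formula k n m, (Gᶜ.indicator 1 Φ + r) := by
        refine Finset.expect_le_expect fun Φ _ => ?_
        by_cases hΦ : Φ ∈ G
        · simpa [hΦ] using h Φ hΦ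
        · rw [Set.indicator_of_mem (Set.mem_compl hΦ), Pi.one_apply]
          exact le_add_of_le_of_nonneg MeasureTheory.measureReal_le_one hr
    _ = prob Gᶜ + r := by
        rw [Finset.expect_add_distrib, Fintype.expect_const, prob_eq_expect_indicator]

theorem allNegative_resampleClause : AllNegative (resampleClause C v) ↔ AllNegative C := by
  unfold resampleClause
  split_ifs with h
  · simp only [h, iff_true]
    exact fun _ => rfl
  · rfl

theorem AllNegative.not_uniqueAt (h : AllNegative C) (x : Fin n) : ¬ UniqueAt Z C x := by
  rintro ⟨-, j, hj, -⟩
  simpa [hj] using h j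

theorem uniqueAt_resampleClause {x : Fin n} :
    UniqueAt Z (resampleClause C v) x ↔ UniqueAt Z C x := by
  by_cases h : AllNegative C
  · exact iff_of_false ((allNegative_resampleClause.2 h).not_uniqueAt x) (h.not_uniqueAt x)
  · simp only [resampleClause, h, if_false]

theorem zSafe_resample {y : Fin m → Fin k → Fin n} {x : Fin n} :
    ZSafe (resample Φ y) Z x ↔ ZSafe Φ Z x := by
  simp only [zSafe_iff, resample, uniqueAt_resampleClause]

end Resampling

section Phase1

variable {k n m : ℕ} {Φ : Formula k n m} {Z : Finset (Fin n)} {i : Fin m}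

/-- The position `k₁` (counted from `1`) of a `k`-clause, whose variable is added to `Z` if no
variable before it is safe. -/
def fallbackPos (hk : 0 < k) : Fin k := ⟨k₁ k - 1, k₁_sub_one_lt hk⟩

theorem mem_Iio_fallbackPos (hk : 0 < k) {j : Fin k} :
    j ∈ Finset.Iio (fallbackPos hk) ↔ (j : ℕ) + 1 < k₁ k := by
  rw [Finset.mem_Iio, Fin.lt_def]
  exact Nat.lt_sub_iff_add_lt

theorem phase1Step_of_not (h : ¬ (AllNegative (Φ i) ∧ ¬ MeetsVars Z (Φ i))) :
    phase1Step Φ Z i = Z := if_neg h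

theorem phase1Step_of_pos (hk : 0 < k) (h : AllNegative (Φ i) ∧ ¬ MeetsVars Z (Φ i)) :
    (∃ j, ZSafe Φ Z (Φ i j).1 ∧ phase1Step Φ Z i = insert (Φ i j).1 Z) ∨
      (∀ j ∈ Finset.Iio (fallbackPos hk), ¬ ZSafe Φ Z (Φ i j).1) ∧
        phase1Step Φ Z i = insert (Φ i (fallbackPos hk)).1 Z := by
  unfold phase1Step
  rw [if_pos h]
  split_ifs with hs
  · exact Or.inl ⟨_, (Finset.mem_filter.1 (Finset.min'_mem _ hs)).2.2, rfl⟩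
  · exact Or.inr ⟨fun j hj hsafe => hs ⟨j, Finset.mem_filter.2
      ⟨Finset.mem_univ _, (mem_Iio_fallbackPos hk).1 hj, hsafe⟩⟩, rfl⟩

theorem exists_phase1Step_eq_insert (hk : 0 < k)
    (h : AllNegative (Φ i) ∧ ¬ MeetsVars Z (Φ i)) :
    ∃ j, phase1Step Φ Z i = insert (Φ i j).1 Z := by
  obtain ⟨j, -, hj⟩ | ⟨-, hj⟩ := phase1Step_of_pos hk h
  exacts [⟨j, hj⟩, ⟨_, hj⟩]

theorem subset_phase1Step (hk : 0 < k) (Φ : Formula k n m) (Z : Finset (Fin n)) (i : Fin m) :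
    Z ⊆ phase1Step Φ Z i := by
  by_cases h : AllNegative (Φ i) ∧ ¬ MeetsVars Z (Φ i)
  · obtain ⟨j, hj⟩ := exists_phase1Step_eq_insert hk h
    exact hj ▸ Finset.subset_insert _ _
  · exact (phase1Step_of_not h).superset

theorem subset_foldl_phase1Step (hk : 0 < k) (Φ : Formula k n m) (l : List (Fin m))
    (Z : Finset (Fin n)) : Z ⊆ l.foldl (phase1Step Φ) Z := by
  induction l generalizing Z with
  | nil => exact subset_rfl
  | cons i l ih => exact (subset_phase1Step hk Φ Z i).trans (ih _)

theorem MeetsVars.mono {Z' : Finset (Fin n)} {C : Clause k n} (h : MeetsVars Z C)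
    (hZ : Z ⊆ Z') : MeetsVars Z' C :=
  h.imp fun _ hj => hZ hj

theorem meetsVars_phase1Step (hk : 0 < k) (Z : Finset (Fin n)) (h : AllNegative (Φ i)) :
    MeetsVars (phase1Step Φ Z i) (Φ i) := by
  by_cases hm : MeetsVars Z (Φ i)
  · exact hm.mono (subset_phase1Step hk Φ Z i)
  · obtain ⟨j, hj⟩ := exists_phase1Step_eq_insert hk ⟨h, hm⟩
    exact ⟨j, hj ▸ Finset.mem_insert_self _ _⟩

theorem meetsVars_phase1 (hk : 0 < k) (h : AllNegative (Φ i)) : MeetsVars (phase1 Φ) (Φ i) := by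
  obtain ⟨l, l', hl⟩ := List.append_of_mem (List.mem_finRange i)
  rw [phase1, hl, List.foldl_append, List.foldl_cons]
  exact (meetsVars_phase1Step hk _ h).mono (subset_foldl_phase1Step hk Φ _ _)

/-- The step of Phase 1 at clause `i` when the variables of the all-negative clauses of `Φ` are
replaced by `v`. Which variables are safe depends only on the other clauses, so the vectors used at
different clauses do not interact. -/
def resampledStep (Φ : Formula k n m) (Z : Finset (Fin n)) (i : Fin m) (v : Fin k → Fin n) :
    Finset (Fin n) :=
  phase1Step (resample Φ fun _ => v) Z i

theorem phase1Step_resample (Φ : Formula k n m) (y : Fin m → Fin k → Fin n) (Z : Finset (Fin n))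
    (i : Fin m) : phase1Step (resample Φ y) Z i = resampledStep Φ Z i (y i) := by
  simp only [resampledStep, phase1Step, safePositions, zSafe_resample, resample]

theorem phase1_resample (Φ : Formula k n m) (y : Fin m → Fin k → Fin n) :
    phase1 (resample Φ y) =
      (List.finRange m).foldl (fun Z i => resampledStep Φ Z i (y i)) ∅ := by
  simp only [phase1, funext₂ (phase1Step_resample Φ y)]

variable {v : Fin k → Fin n}

theorem resampledStep_of_not_allNegative (h : ¬ AllNegative (Φ i)) :
    resampledStep Φ Z i v = Z :=
  phase1Step_of_not fun h' => h (allNegative_resampleClause.1 h'.1)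

theorem resample_apply_of_allNegative (h : AllNegative (Φ i)) (y : Fin m → Fin k → Fin n) :
    resample Φ y i = fun j => (y i j, false) := if_pos h

theorem resampledStep_of_mem (h : AllNegative (Φ i)) (hv : ∃ j, v j ∈ Z) :
    resampledStep Φ Z i v = Z :=
  phase1Step_of_not fun h' => h'.2 <| by
    simpa only [MeetsVars, resample_apply_of_allNegative h] using hv

theorem resampledStep_of_forall_notMem (hk : 0 < k) (h : AllNegative (Φ i)) (hv : ∀ j, v j ∉ Z) :
    (∃ j, ZSafe Φ Z (v j) ∧ resampledStep Φ Z i v = insert (v j) Z) ∨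
      (∀ j ∈ Finset.Iio (fallbackPos hk), ¬ ZSafe Φ Z (v j)) ∧
        resampledStep Φ Z i v = insert (v (fallbackPos hk)) Z := by
  have h' : AllNegative (resample Φ (fun _ => v) i) ∧ ¬ MeetsVars Z (resample Φ (fun _ => v) i) :=
    ⟨allNegative_resampleClause.2 h, by
      simpa only [MeetsVars, resample_apply_of_allNegative h, not_exists] using hv⟩
  simpa only [resampledStep, zSafe_resample, resample_apply_of_allNegative h] using
    phase1Step_of_pos hk h'

/-- The number of unsatisfied clauses under `σ_Z`, not counting the all-negative clauses and the
clauses with a repeated variable. -/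
def numMixedUnsat (Φ : Formula k n m) (Z : Finset (Fin n)) : ℕ :=
  (Finset.univ.filter fun i => ¬ AllNegative (Φ i) ∧ DistinctVars (Φ i) ∧
    ¬ Satisfies (sigma Z) (Φ i)).card

/-- The number of `Z`-unique clauses in which `x` is the unique true variable. -/
def numUniqueAt (Φ : Formula k n m) (Z : Finset (Fin n)) (x : Fin n) : ℕ :=
  (Finset.univ.filter fun i => UniqueAt Z (Φ i) x).card

theorem AllNegative.satisfies_sigma {C : Clause k n} (h : AllNegative C) (hZ : MeetsVars Z C) :
    Satisfies (sigma Z) C := by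
  obtain ⟨j, hj⟩ := hZ
  exact ⟨j, by simp [sigma, hj, h j]⟩

theorem numUnsat_phase1_le (hk : 0 < k) (Φ : Formula k n m) :
    numUnsat Φ (sigma (phase1 Φ)) ≤ numMixedUnsat Φ (phase1 Φ) +
      (Finset.univ.filter fun i => ¬ DistinctVars (Φ i)).card := by
  refine le_trans (Finset.card_le_card fun i hi => ?_) (Finset.card_union_le _ _)
  simp only [Finset.mem_union, Finset.mem_filter, Finset.mem_univ, true_and] at hi ⊢
  have hneg : ¬ AllNegative (Φ i) := fun h => hi (h.satisfies_sigma (meetsVars_phase1 hk h))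
  tauto

theorem numMixedUnsat_empty (Φ : Formula k n m) : numMixedUnsat Φ ∅ = 0 := by
  refine Finset.card_eq_zero.2 (Finset.filter_eq_empty_iff.2 fun i _ ⟨hneg, _, hunsat⟩ => ?_)
  refine hneg fun j => ?_
  simpa [sigma] using not_exists.1 hunsat j

theorem uniqueAt_of_satisfies_of_not_satisfies_insert {C : Clause k n} {x : Fin n}
    (hC : DistinctVars C) (hx : x ∉ Z) (h : Satisfies (sigma Z) C)
    (h' : ¬ Satisfies (sigma (insert x Z)) C) : UniqueAt Z C x := by
  have hsigma : ∀ z, z ≠ x → sigma (insert x Z) z = sigma Z z := fun z hz => by simp [sigma, hz]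
  obtain ⟨j, hj⟩ := h
  have hjx : (C j).1 = x := by_contra fun hne => h' ⟨j, (hsigma _ hne).trans hj⟩
  refine ⟨hx, j, Prod.ext hjx (by simpa [hjx, sigma, hx] using hj.symm), fun i hij hi => h' ⟨i, ?_⟩⟩
  rw [hsigma _ fun hix => hij (hC (hix.trans hjx.symm)), hi]

theorem numMixedUnsat_insert_le (Φ : Formula k n m) {x : Fin n} (hx : x ∉ Z) :
    numMixedUnsat Φ (insert x Z) ≤ numMixedUnsat Φ Z + numUniqueAt Φ Z x := by
  refine le_trans (Finset.card_le_card fun i hi => ?_) (Finset.card_union_le _ _)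
  simp only [Finset.mem_union, Finset.mem_filter, Finset.mem_univ, true_and] at hi ⊢
  obtain ⟨hneg, hd, hi⟩ := hi
  by_cases h : Satisfies (sigma Z) (Φ i)
  · exact Or.inr (uniqueAt_of_satisfies_of_not_satisfies_insert hd hx h hi)
  · exact Or.inl ⟨hneg, hd, h⟩

theorem numMixedUnsat_resample (Φ : Formula k n m) (y : Fin m → Fin k → Fin n)
    (Z : Finset (Fin n)) : numMixedUnsat (resample Φ y) Z = numMixedUnsat Φ Z := by
  unfold numMixedUnsat
  refine congrArg _ (Finset.filter_congr fun i _ => ?_)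
  simp only [resample, allNegative_resampleClause]
  refine and_congr_right fun h => ?_
  simp only [resampleClause, h, if_false]

theorem sum_numUniqueAt_le (Φ : Formula k n m) (Z : Finset (Fin n)) :
    ∑ x, numUniqueAt Φ Z x ≤ numZUnique Φ Z := by
  have hdisj : ((Finset.univ : Finset (Fin n)) : Set (Fin n)).PairwiseDisjoint
      fun x => Finset.univ.filter fun i => UniqueAt Z (Φ i) x := fun x _ y _ hxy =>
    Finset.disjoint_filter.2 fun i _ hx hy => hxy (hx.eq hy)
  simp only [numUniqueAt, ← Finset.card_biUnion hdisj]
  refine Finset.card_le_card fun i hi => ?_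
  simpa [zUnique_iff_exists_uniqueAt] using hi

theorem ZSafe.numUniqueAt_eq_zero {x : Fin n} (h : ZSafe Φ Z x) : numUniqueAt Φ Z x = 0 :=
  Finset.card_eq_zero.2 (Finset.filter_eq_empty_iff.2 fun i _ => (zSafe_iff.1 h).2 i)

end Phase1

section Vectors

open scoped BigOperators

variable {ι β : Type*} [Fintype ι] [DecidableEq ι]

theorem expect_ite_forall_mem [Fintype β] [Nonempty β] [MeasurableSpace β]
    [MeasurableSingletonClass β] (s : Finset ι) {i : ι} (hi : i ∉ s) (P : β → Prop)
    [∀ v : ι → β, Decidable (∀ j ∈ s, P (v j))] (f : β → ℝ) :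
    (𝔼 v : ι → β, if ∀ j ∈ s, P (v j) then f (v i) else 0) =
      prob {b | P b} ^ s.card * 𝔼 b, f b := by
  classical
  let F (j : ι) (b : β) : ℝ :=
    (if j ∈ s then if P b then 1 else 0 else 1) * if j = i then f b else 1
  have hprod : ∀ v : ι → β, (if ∀ j ∈ s, P (v j) then f (v i) else 0) = ∏ j, F j (v j) :=
    fun v => by
      simp only [F, Finset.prod_mul_distrib, Fintype.prod_ite_mem, Finset.prod_ite_zero,
        Finset.prod_const_one, Fintype.prod_ite_eq']
      simp only [ite_mul, one_mul, zero_mul]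
  have hF : ∀ j, 𝔼 b, F j b =
      (if j ∈ s then prob {b | P b} else 1) * if j = i then 𝔼 b, f b else 1 := fun j => by
    by_cases hj : j = i
    · subst hj
      simp only [F, hi, if_false, if_true, one_mul]
    · by_cases hjs : j ∈ s
      · simp only [F, hj, hjs, if_false, if_true, mul_one, prob_setOf_eq_expect]
      · simp only [F, hj, hjs, if_false, mul_one, Fintype.expect_const]
  simp only [hprod, expect_pi_prod, hF, Finset.prod_mul_distrib, Fintype.prod_ite_mem,
    Finset.prod_const, Fintype.prod_ite_eq']

variable {n : ℕ} [NeZero n]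

theorem prob_notMem (S : Finset (Fin n)) : prob {x | x ∉ S} = 1 - S.card / n := by
  have hn : (n : ℝ) ≠ 0 := NeZero.ne _
  rw [prob_setOf_eq_expect, Fintype.expect_eq_sum_div_card, Finset.sum_boole,
    Finset.filter_notMem_eq_sdiff, ← Finset.compl_eq_univ_sdiff, Finset.card_compl,
    Fintype.card_fin, Nat.cast_sub (card_finset_fin_le S), sub_div, div_self hn]

theorem prob_notMem_pow_le (S : Finset (Fin n)) {s : ℝ} (hs : s ≤ S.card) (j : ℕ) :
    prob {x | x ∉ S} ^ j ≤ Real.exp (-(j * s / n)) := by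
  have hle : prob {x | x ∉ S} ≤ Real.exp (-(s / n)) := by
    have : s / n ≤ S.card / n := by gcongr
    rw [prob_notMem]
    linarith [Real.add_one_le_exp (-(s / n))]
  calc prob {x | x ∉ S} ^ j ≤ Real.exp (-(s / n)) ^ j :=
        pow_le_pow_left₀ MeasureTheory.measureReal_nonneg hle j
    _ = Real.exp (-(j * s / n)) := by
        rw [← Real.exp_nat_mul]
        ring_nf

end Vectors

section Drift

open scoped BigOperators

variable {k n m : ℕ} {Φ : Formula k n m} {Z : Finset (Fin n)} {i : Fin m}

/-- The number of all-negative clauses. -/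
def numAllNegative (Φ : Formula k n m) : ℕ := (Finset.univ.filter fun i => AllNegative (Φ i)).card

theorem expect_phase1_resample_le [NeZero n] (Φ : Formula k n m) {W : Finset (Fin n) → ℝ} {a : ℝ}
    (h : ∀ i Z, AllNegative (Φ i) → 𝔼 v, W (resampledStep Φ Z i v) ≤ Real.exp a * W Z) :
    𝔼 y, W (phase1 (resample Φ y)) ≤ Real.exp (numAllNegative Φ * a) * W ∅ := by
  calc 𝔼 y, W (phase1 (resample Φ y))
      ≤ (∏ i, if AllNegative (Φ i) then Real.exp a else 1) * W ∅ := by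
        simp only [phase1_resample]
        refine expect_foldl_le (m := m) (fun i Z v => resampledStep Φ Z i v)
          (fun i => by split_ifs <;> positivity) (fun i Z => ?_) ∅
        split_ifs with hi
        · exact h i Z hi
        · simp only [resampledStep_of_not_allNegative hi, Fintype.expect_const, one_mul, le_refl]
    _ = Real.exp (numAllNegative Φ * a) * W ∅ := by
        rw [← Finset.prod_filter, Finset.prod_const, Real.exp_nat_mul, numAllNegative]

theorem card_resampledStep_le (hk : 0 < k) (hi : AllNegative (Φ i)) (v : Fin k → Fin n) :
    (resampledStep Φ Z i v).card ≤ Z.card + if ∀ j, v j ∉ Z then 1 else 0 := by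
  split_ifs with hv
  · obtain ⟨j, -, hj⟩ | ⟨-, hj⟩ := resampledStep_of_forall_notMem hk hi hv <;>
      exact hj ▸ Finset.card_insert_le _ _
  · rw [resampledStep_of_mem hi (by simpa using hv), add_zero]

theorem expect_exp_card_resampledStep_le [NeZero n] (hk : 0 < k) (hi : AllNegative (Φ i))
    (h : ℕ) :
    𝔼 v, Real.exp ((resampledStep Φ Z i v).card - h : ℕ) ≤
      Real.exp (2 * Real.exp (-(k * h / n))) * Real.exp (Z.card - h : ℕ) := by
  obtain hZ | hZ := lt_or_ge Z.card h
  · have hstep : ∀ v, (resampledStep Φ Z i v).card - h = 0 := fun v => by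
      have := card_resampledStep_le (Z := Z) hk hi v
      split_ifs at this <;> omega
    simp only [hstep, Nat.sub_eq_zero_of_le hZ.le, Fintype.expect_const, Nat.cast_zero,
      Real.exp_zero, mul_one]
    exact Real.one_le_exp (by positivity)
  have hstep : ∀ v, Real.exp ((resampledStep Φ Z i v).card - h : ℕ) ≤
      (1 + 2 * if ∀ j, v j ∉ Z then 1 else 0) * Real.exp (Z.card - h : ℕ) := fun v => by
    have hcard := card_resampledStep_le (Z := Z) hk hi v
    split_ifs at hcard ⊢
    · calc Real.exp ((resampledStep Φ Z i v).card - h : ℕ)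
          ≤ Real.exp ((1 + (Z.card - h) : ℕ)) :=
            Real.exp_le_exp.2 (Nat.cast_le.2 (by omega))
        _ ≤ (1 + 2 * 1) * Real.exp (Z.card - h : ℕ) := by
            rw [Nat.cast_add, Real.exp_add, Nat.cast_one]
            gcongr
            linarith [Real.exp_one_lt_d9]
    · rw [mul_zero, add_zero, one_mul]
      exact Real.exp_le_exp.2 (Nat.cast_le.2 (by omega))
  have hmiss : prob {v : Fin k → Fin n | ∀ j, v j ∉ Z} ≤ Real.exp (-(k * h / n)) := by
    have := prob_forall_mem_finset (Finset.univ : Finset (Fin k)) fun _ => {x : Fin n | x ∉ Z}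
    simp only [Finset.mem_univ, true_imp_iff, Set.mem_ofPred_eq, Finset.prod_const,
      Finset.card_univ, Fintype.card_fin] at this
    exact this ▸ prob_notMem_pow_le Z (Nat.cast_le.2 hZ) k
  calc 𝔼 v, Real.exp ((resampledStep Φ Z i v).card - h : ℕ)
      ≤ (1 + 2 * prob {v : Fin k → Fin n | ∀ j, v j ∉ Z}) * Real.exp (Z.card - h : ℕ) := by
        refine (Finset.expect_le_expect fun v _ => hstep v).trans_eq ?_
        rw [← Finset.expect_mul, Finset.expect_add_distrib, Fintype.expect_const,
          ← Finset.mul_expect, ← prob_setOf_eq_expect]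
    _ ≤ Real.exp (2 * Real.exp (-(k * h / n))) * Real.exp (Z.card - h : ℕ) := by
        gcongr
        linarith [Real.add_one_le_exp (2 * Real.exp (-(k * h / n)))]

theorem prob_lt_card_phase1_resample_le [NeZero n] (hk : 0 < k) (Φ : Formula k n m) (h : ℕ)
    (T : ℝ) :
    prob {y | T < ((phase1 (resample Φ y)).card : ℝ)} ≤
      Real.exp (numAllNegative Φ * (2 * Real.exp (-(k * h / n))) - (T - h)) := by
  have hdrift := expect_phase1_resample_le Φ (W := fun Z => Real.exp (Z.card - h : ℕ))
    fun i Z hi => expect_exp_card_resampledStep_le hk hi h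
  simp only [Finset.card_empty, Nat.zero_sub, Nat.cast_zero, Real.exp_zero, mul_one] at hdrift
  rw [Real.exp_sub]
  refine (prob_le_expect_div (Real.exp_pos _) (fun y => (Real.exp_pos _).le) fun y hy => ?_).trans
    (div_le_div_of_nonneg_right hdrift (Real.exp_pos _).le)
  refine Real.exp_le_exp.2 ((sub_le_sub_right (le_of_lt hy) _).trans ?_)
  rw [sub_le_iff_le_add]
  exact_mod_cast le_tsub_add

theorem numMixedUnsat_resampledStep_le (hk : 0 < k) (hi : AllNegative (Φ i))
    (v : Fin k → Fin n) :
    numMixedUnsat Φ (resampledStep Φ Z i v) ≤ numMixedUnsat Φ Z +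
      if ∀ j ∈ Finset.Iio (fallbackPos hk), ¬ ZSafe Φ Z (v j) then
        numUniqueAt Φ Z (v (fallbackPos hk)) else 0 := by
  by_cases hv : ∀ j, v j ∉ Z
  · obtain ⟨j, hsafe, hj⟩ | ⟨hnone, hj⟩ := resampledStep_of_forall_notMem hk hi hv
    · have := numMixedUnsat_insert_le Φ hsafe.1
      rw [hsafe.numUniqueAt_eq_zero, ← hj] at this
      exact this.trans (Nat.add_le_add_left (Nat.zero_le _) _)
    · rw [hj, if_pos hnone]
      exact numMixedUnsat_insert_le Φ (hv _)
  · rw [resampledStep_of_mem hi (by simpa using hv)]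
    exact Nat.le_add_right _ _

theorem expect_fallback_numUniqueAt_le [NeZero n] (hk : 0 < k) {s K : ℝ}
    (hsafe : s ≤ (Finset.univ.filter (ZSafe Φ Z)).card) (huniq : (numZUnique Φ Z : ℝ) ≤ K) :
    (𝔼 v : Fin k → Fin n, if ∀ j ∈ Finset.Iio (fallbackPos hk), ¬ ZSafe Φ Z (v j) then
        (numUniqueAt Φ Z (v (fallbackPos hk)) : ℝ) else 0) ≤
      Real.exp (-((k₁ k - 1 : ℕ) * s / n)) * (K / n) := by
  have hS := prob_notMem_pow_le _ hsafe (k₁ k - 1)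
  simp only [Finset.mem_filter, Finset.mem_univ, true_and] at hS
  rw [expect_ite_forall_mem _ (Finset.notMem_Iio_self) (fun x => ¬ ZSafe Φ Z x)
    (fun x => (numUniqueAt Φ Z x : ℝ)), Fin.card_Iio, fallbackPos]
  refine mul_le_mul hS ?_ (Finset.expect_nonneg fun x _ => Nat.cast_nonneg _) (Real.exp_pos _).le
  rw [Fintype.expect_eq_sum_div_card, Fintype.card_fin]
  gcongr
  exact le_trans (by exact_mod_cast sum_numUniqueAt_le Φ Z) huniq

theorem expect_exp_numMixedUnsat_resampledStep_le [NeZero n] (hk : 0 < k)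
    (hi : AllNegative (Φ i)) {s K l : ℝ} (hl : 0 ≤ l)
    (hsafe : s ≤ (Finset.univ.filter (ZSafe Φ Z)).card) (huniq : (numZUnique Φ Z : ℝ) ≤ K)
    (hdeg : ∀ x, l * numUniqueAt Φ Z x ≤ 1) :
    𝔼 v, Real.exp (l * numMixedUnsat Φ (resampledStep Φ Z i v)) ≤
      Real.exp (Real.exp (-((k₁ k - 1 : ℕ) * s / n)) * (2 * l * K / n)) *
        Real.exp (l * numMixedUnsat Φ Z) := by
  let growth (v : Fin k → Fin n) : ℝ :=
    if ∀ j ∈ Finset.Iio (fallbackPos hk), ¬ ZSafe Φ Z (v j) then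
      (numUniqueAt Φ Z (v (fallbackPos hk)) : ℝ) else 0
  have hexp : ∀ v, Real.exp (l * growth v) ≤ 1 + 2 * l * growth v := fun v => by
    have hnonneg : 0 ≤ l * growth v := by
      simp only [growth]
      split_ifs <;> positivity
    have hle : l * growth v ≤ 1 := by
      simp only [growth]
      split_ifs
      exacts [hdeg _, by simp]
    have := Real.abs_exp_sub_one_le ((abs_of_nonneg hnonneg).trans_le hle)
    rw [abs_of_nonneg hnonneg] at this
    linarith [le_abs_self (Real.exp (l * growth v) - 1)]
  calc 𝔼 v, Real.exp (l * numMixedUnsat Φ (resampledStep Φ Z i v))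
      ≤ 𝔼 v, (1 + 2 * l * growth v) * Real.exp (l * numMixedUnsat Φ Z) := by
        refine Finset.expect_le_expect fun v _ => ?_
        have hstep : (numMixedUnsat Φ (resampledStep Φ Z i v) : ℝ) ≤
            growth v + numMixedUnsat Φ Z := by
          rw [add_comm]
          simp only [growth]
          exact_mod_cast numMixedUnsat_resampledStep_le hk hi v
        refine (Real.exp_le_exp.2 (mul_le_mul_of_nonneg_left hstep hl)).trans ?_
        rw [mul_add, Real.exp_add]
        gcongr
        exact hexp v
    _ = (1 + 2 * l * 𝔼 v, growth v) * Real.exp (l * numMixedUnsat Φ Z) := by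
        rw [← Finset.expect_mul, Finset.expect_add_distrib, Fintype.expect_const,
          ← Finset.mul_expect]
    _ ≤ Real.exp (Real.exp (-((k₁ k - 1 : ℕ) * s / n)) * (2 * l * K / n)) *
        Real.exp (l * numMixedUnsat Φ Z) := by
        gcongr
        refine le_trans ?_ (Real.add_one_le_exp _)
        have := mul_le_mul_of_nonneg_left (expect_fallback_numUniqueAt_le hk hsafe huniq)
          (by positivity : 0 ≤ 2 * l)
        linarith [show 2 * l * (Real.exp (-((k₁ k - 1 : ℕ) * s / n)) * (K / n)) =
          Real.exp (-((k₁ k - 1 : ℕ) * s / n)) * (2 * l * K / n) by ring]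

theorem prob_lt_numMixedUnsat_phase1_resample_le [NeZero n] (hk : 0 < k) (Φ : Formula k n m)
    {θ s K l : ℝ} (hl : 0 ≤ l)
    (hsafe : ∀ Z : Finset (Fin n), (Z.card : ℝ) ≤ θ → s ≤ (Finset.univ.filter (ZSafe Φ Z)).card)
    (huniq : ∀ Z : Finset (Fin n), (Z.card : ℝ) ≤ θ → (numZUnique Φ Z : ℝ) ≤ K)
    (hdeg : ∀ Z x, l * numUniqueAt Φ Z x ≤ 1) (T : ℝ) :
    prob {y | ((phase1 (resample Φ y)).card : ℝ) ≤ θ ∧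
      T < (numMixedUnsat Φ (phase1 (resample Φ y)) : ℝ)} ≤
      Real.exp (numAllNegative Φ *
        (Real.exp (-((k₁ k - 1 : ℕ) * s / n)) * (2 * l * K / n)) - l * T) := by
  let W (Z : Finset (Fin n)) : ℝ :=
    if (Z.card : ℝ) ≤ θ then Real.exp (l * numMixedUnsat Φ Z) else 0
  have hW : ∀ Z, 0 ≤ W Z := fun Z => by
    simp only [W]
    split_ifs <;> positivity
  have hWle : ∀ Z, W Z ≤ Real.exp (l * numMixedUnsat Φ Z) := fun Z => by
    simp only [W]
    split_ifs
    exacts [le_rfl, (Real.exp_pos _).le]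
  have hdrift := expect_phase1_resample_le Φ (W := W)
      (a := Real.exp (-((k₁ k - 1 : ℕ) * s / n)) * (2 * l * K / n)) fun i Z hi => by
    by_cases hZ : (Z.card : ℝ) ≤ θ
    · rw [show W Z = Real.exp (l * numMixedUnsat Φ Z) from if_pos hZ]
      exact (Finset.expect_le_expect fun v _ => hWle _).trans
        (expect_exp_numMixedUnsat_resampledStep_le hk hi hl (hsafe Z hZ) (huniq Z hZ) (hdeg Z))
    · have hstep : ∀ v, W (resampledStep Φ Z i v) = 0 := fun v => if_neg fun h => hZ <|
        (Nat.cast_le.2 (Finset.card_le_card (subset_phase1Step hk _ Z i))).trans h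
      simp only [hstep, Fintype.expect_const]
      exact mul_nonneg (Real.exp_pos _).le (hW Z)
  have hW₀ : W ∅ ≤ 1 := (hWle ∅).trans (by simp [numMixedUnsat_empty])
  rw [Real.exp_sub]
  refine (prob_le_expect_div (Real.exp_pos _) (fun y => hW _) fun y hy => ?_).trans
    (div_le_div_of_nonneg_right (hdrift.trans (mul_le_of_le_one_right (Real.exp_pos _).le hW₀))
      (Real.exp_pos _).le)
  rw [show W (phase1 (resample Φ y)) = _ from if_pos hy.1]
  exact Real.exp_le_exp.2 (mul_le_mul_of_nonneg_left hy.2.le hl)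

end Drift

section WithHighProbability

open MeasureTheory ProbabilityTheory

section General

variable {Ω : ℕ → Type*} [∀ n, MeasurableSpace (Ω n)] {P Q : ∀ n, Ω n → Prop}

/-- The property `P n` of a uniformly random element of `Ω n` holds with high probability as `n`
tends to infinity. -/
def WHP (P : ∀ n, Ω n → Prop) : Prop := Tendsto (fun n => prob {a | ¬ P n a}) atTop (𝓝 0)

theorem WHP.of_le {b : ℕ → ℝ} (hb : Tendsto b atTop (𝓝 0))
    (h : ∀ᶠ n in atTop, prob {a | ¬ P n a} ≤ b n) : WHP P :=
  squeeze_zero' (.of_forall fun _ => measureReal_nonneg) h hb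

theorem WHP.mono (hP : WHP P) (h : ∀ n a, P n a → Q n a) : WHP Q :=
  .of_le hP <| .of_forall fun n =>
    measureReal_mono (fun a => mt (h n a)) (measure_ne_top _ _)

theorem WHP.and (hP : WHP P) (hQ : WHP Q) : WHP fun n a => P n a ∧ Q n a := by
  refine .of_le (b := fun n => prob {a | ¬ P n a} + prob {a | ¬ Q n a}) ?_
    (.of_forall fun n => ?_)
  · simpa only [add_zero] using hP.add hQ
  · simp only [not_and_or]
    exact measureReal_union_le _ _

end General

section Formulas

variable {k : ℕ} {m : ℕ → ℕ} {P G : ∀ n, Formula k n (m n) → Prop}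

theorem WHP.of_resample {r : ℕ → ℝ} (hG : WHP G) (hr₀ : ∀ n, 0 ≤ r n)
    (hr : Tendsto r atTop (𝓝 0))
    (h : ∀ᶠ n in atTop, ∀ Φ, G n Φ → prob {y | ¬ P n (resample Φ y)} ≤ r n) : WHP P := by
  refine .of_le (b := fun n => prob {Φ | ¬ G n Φ} + r n) ?_ ?_
  · simpa only [add_zero] using hG.add hr
  · filter_upwards [h, eventually_ne_atTop 0] with n h hn
    have : NeZero n := ⟨hn⟩
    exact prob_le_of_resample (hr₀ n) h

theorem WHP.tendsto_uniformFormula (h : WHP P) :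
    Tendsto (fun n => uniformFormula k n (m n) {Φ | P n Φ}) atTop (𝓝 1) := by
  have hlim := ENNReal.tendsto_ofReal (h.const_sub 1)
  rw [sub_zero, ENNReal.ofReal_one] at hlim
  refine hlim.congr' ?_
  filter_upwards [eventually_ne_atTop 0] with n hn
  have : NeZero n := ⟨hn⟩
  have hcompl := probReal_compl_eq_one_sub (μ := uniformOn (Set.univ : Set (Formula k n (m n))))
    (s := {Φ | P n Φ}) (Set.toFinite _).measurableSet
  rw [prob, show {Φ | ¬ P n Φ} = {Φ | P n Φ}ᶜ from rfl, hcompl, sub_sub_cancel,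
    ofReal_measureReal, uniformFormula]

end Formulas

end WithHighProbability

section Limits

theorem tendsto_exp_natCast_mul {c : ℝ} (hc : c < 0) :
    Tendsto (fun n : ℕ => Real.exp (n * c)) atTop (𝓝 0) :=
  Real.tendsto_exp_atBot.comp (tendsto_natCast_atTop_atTop.atTop_mul_const_of_neg hc)

theorem tendsto_exp_sqrt_mul {c : ℝ} (hc : c < 0) :
    Tendsto (fun n : ℕ => Real.exp (√n * c)) atTop (𝓝 0) :=
  Real.tendsto_exp_atBot.comp
    ((Real.tendsto_sqrt_atTop.comp tendsto_natCast_atTop_atTop).atTop_mul_const_of_neg hc)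

theorem tendsto_natCast_mul_exp_sub_sqrt (A : ℝ) :
    Tendsto (fun n : ℕ => n * Real.exp (A - √n)) atTop (𝓝 0) := by
  have h := ((Real.tendsto_pow_mul_exp_neg_atTop_nhds_zero 2).comp
    (Real.tendsto_sqrt_atTop.comp tendsto_natCast_atTop_atTop)).const_mul (Real.exp A)
  rw [mul_zero] at h
  refine h.congr fun n => ?_
  rw [Function.comp_apply, Function.comp_apply, Real.sq_sqrt (Nat.cast_nonneg n), sub_eq_add_neg,
    Real.exp_add]
  ring

theorem exp_neg_le_one_sub_pow {p w : ℝ} {m : ℕ} (hp : p * (w + 1) ≤ 1) (hw : 0 < w)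
    (hm : m * p ≤ w) : Real.exp (-(w + 1)) ≤ (1 - p) ^ m := by
  have hp₁ : 0 < 1 - p := by nlinarith
  have hlog : m * -Real.log (1 - p) ≤ w + 1 := by
    calc m * -Real.log (1 - p) ≤ m * (p / (1 - p)) := by
          gcongr
          have := Real.one_sub_inv_le_log_of_pos hp₁
          refine neg_le.1 (le_trans (le_of_eq ?_) this)
          field_simp
          ring
      _ ≤ w + 1 := by
          rw [← mul_div_assoc, div_le_iff₀ hp₁]
          linarith
  calc Real.exp (-(w + 1)) ≤ Real.exp (m * Real.log (1 - p)) := Real.exp_le_exp.2 (by linarith)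
    _ = (1 - p) ^ m := by rw [Real.exp_nat_mul, Real.exp_log hp₁]

end Limits

section Events

variable {k : ℕ} {m : ℕ → ℕ} {w τ : ℝ}

theorem prob_exists_card_le_le {n M : ℕ} {θ y b : ℝ} (hy₀ : 0 < y) (hy₁ : y ≤ 1)
    {S : Finset (Fin n) → Set (Formula k n M)}
    (hS : ∀ Z : Finset (Fin n), (Z.card : ℝ) ≤ θ → prob (S Z) ≤ Real.exp b) :
    prob {Φ | ∃ Z : Finset (Fin n), (Z.card : ℝ) ≤ θ ∧ Φ ∈ S Z} ≤
      Real.exp (n * y - θ * Real.log y + b) := by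
  refine (prob_le_sum (Finset.univ.filter fun Z : Finset (Fin n) => (Z.card : ℝ) ≤ θ) S
    fun Φ hΦ => ?_).trans ?_
  · obtain ⟨Z, hZ, hΦ⟩ := hΦ
    exact ⟨Z, by simpa using hZ, hΦ⟩
  refine (Finset.sum_le_card_nsmul _ _ _ fun Z hZ => hS Z (Finset.mem_filter.1 hZ).2).trans ?_
  rw [nsmul_eq_mul, Real.exp_add]
  gcongr
  simpa using card_filter_card_le (β := Fin n) θ hy₀ hy₁

theorem whp_numZUnique_le (hm : ∀ n, (m n : ℝ) * (k / 2 ^ k) ≤ w * n) {y l K : ℝ} (hy₀ : 0 < y)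
    (hy₁ : y ≤ 1) (hl : 0 ≤ l)
    (h : y - τ * Real.log y + (w * (Real.exp l - 1) - l * K) < 0) :
    WHP fun n (Φ : Formula k n (m n)) =>
      ∀ Z : Finset (Fin n), (Z.card : ℝ) ≤ τ * n → (numZUnique Φ Z : ℝ) ≤ K * n := by
  refine .of_le (tendsto_exp_natCast_mul h) ?_
  filter_upwards [eventually_ne_atTop 0] with n hn
  have : NeZero n := ⟨hn⟩
  have hZ : ∀ Z : Finset (Fin n), prob {Φ : Formula k n (m n) | K * n < numZUnique Φ Z} ≤
      Real.exp (n * (w * (Real.exp l - 1) - l * K)) := fun Z => by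
    refine (chernoff_card_filter (fun C : Clause k n => ZUnique Z C) hl _).trans
      (Real.exp_le_exp.2 ?_)
    have hmean : m n * prob {C : Clause k n | ZUnique Z C} ≤ w * n :=
      (mul_le_mul_of_nonneg_left (prob_zUnique_le Z) (Nat.cast_nonneg _)).trans (hm n)
    have := mul_le_mul_of_nonneg_right hmean (sub_nonneg.2 (Real.one_le_exp hl))
    rw [Fintype.card_fin]
    linarith
  push Not
  refine (prob_exists_card_le_le hy₀ hy₁ fun Z _ => hZ Z).trans_eq ?_
  ring_nf

theorem prob_card_zSafe_lt_le {n M : ℕ} [NeZero n] (Z : Finset (Fin n)) (s : ℝ) :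
    prob {Φ : Formula k n M | ((Finset.univ.filter (ZSafe Φ Z)).card : ℝ) < s} ≤
      Real.exp (s - (1 - k / 2 ^ k / n) ^ M * Zᶜ.card / 2) := by
  have hsafe : ∀ Φ : Formula k n M, Finset.univ.filter (ZSafe Φ Z) =
      Zᶜ.filter fun x => ∀ i, ¬ UniqueAt Z (Φ i) x := fun Φ => by
    ext x
    simp [zSafe_iff]
  have hp : (k / 2 ^ k / n : ℝ) ≤ 1 := by
    rw [div_div, div_le_one (mul_pos (by positivity) (Nat.cast_pos.2 (NeZero.pos n)))]
    exact_mod_cast Nat.lt_two_pow_self.le.trans (Nat.le_mul_of_pos_right _ (NeZero.pos n))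
  simp only [hsafe]
  exact prob_card_unhit_lt_le (fun (C : Clause k n) x => UniqueAt Z C x) Zᶜ (by positivity) hp
    (fun C x _ y _ => UniqueAt.eq) (fun x _ => prob_uniqueAt_le Z x) s

theorem whp_le_card_zSafe (hm : ∀ n, (m n : ℝ) * (k / 2 ^ k) ≤ w * n) (hw : 0 < w) (hτ : τ ≤ 1)
    {y σ : ℝ} (hy₀ : 0 < y) (hy₁ : y ≤ 1)
    (h : y - τ * Real.log y + (σ - Real.exp (-(w + 1)) * (1 - τ) / 2) < 0) :
    WHP fun n (Φ : Formula k n (m n)) => ∀ Z : Finset (Fin n), (Z.card : ℝ) ≤ τ * n →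
      σ * n ≤ (Finset.univ.filter (ZSafe Φ Z)).card := by
  refine .of_le (tendsto_exp_natCast_mul h) ?_
  filter_upwards [eventually_ne_atTop 0, eventually_ge_atTop ⌈w + 1⌉₊] with n hn hwn
  have : NeZero n := ⟨hn⟩
  have hn' : (0 : ℝ) < n := Nat.cast_pos.2 hn.bot_lt
  have hp : (k / 2 ^ k / n : ℝ) * (w + 1) ≤ 1 := by
    have hk : (k / 2 ^ k : ℝ) ≤ 1 := by
      rw [div_le_one (by positivity)]
      exact_mod_cast Nat.lt_two_pow_self.le
    rw [div_mul_eq_mul_div, div_le_one hn']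
    exact (mul_le_of_le_one_left (by linarith) hk).trans (Nat.ceil_le.1 hwn)
  have hunhit : Real.exp (-(w + 1)) ≤ (1 - k / 2 ^ k / n : ℝ) ^ m n :=
    exp_neg_le_one_sub_pow hp hw (by rw [← mul_div_assoc, div_le_iff₀ hn']; exact hm n)
  have hZ : ∀ Z : Finset (Fin n), (Z.card : ℝ) ≤ τ * n →
      prob {Φ : Formula k n (m n) | ((Finset.univ.filter (ZSafe Φ Z)).card : ℝ) < σ * n} ≤
        Real.exp (n * (σ - Real.exp (-(w + 1)) * (1 - τ) / 2)) := fun Z hZ => by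
    have hcard : n * (1 - τ) ≤ (Zᶜ.card : ℝ) := by
      rw [Finset.card_compl, Fintype.card_fin, Nat.cast_sub (card_finset_fin_le Z)]
      linarith
    refine (prob_card_zSafe_lt_le Z _).trans (Real.exp_le_exp.2 ?_)
    have := mul_le_mul hunhit hcard (mul_nonneg hn'.le (by linarith))
      ((Real.exp_pos _).le.trans hunhit)
    linarith
  push Not
  refine (prob_exists_card_le_le hy₀ hy₁ hZ).trans_eq ?_
  ring_nf

theorem whp_card_filter_le {P : ∀ n, Clause k n → Prop} [∀ n, DecidablePred (P n)] {a : ℝ}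
    (ha : 0 < a) (h : ∀ᶠ n in atTop, m n * prob {C | P n C} ≤ a * n) :
    WHP fun n (Φ : Formula k n (m n)) =>
      ((Finset.univ.filter fun i => P n (Φ i)).card : ℝ) ≤ 2 * a * n := by
  have he₀ : 0 ≤ Real.exp 1 - 1 := by linarith [Real.add_one_le_exp (1 : ℝ)]
  have he₁ : a * (Real.exp 1 - 1 - 2) < 0 :=
    mul_neg_of_pos_of_neg ha (by linarith [Real.exp_one_lt_d9])
  refine .of_le (tendsto_exp_natCast_mul he₁) ?_
  filter_upwards [h, eventually_ne_atTop 0] with n h hn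
  have : NeZero n := ⟨hn⟩
  simp only [not_le]
  refine (chernoff_card_filter (P n) zero_le_one _).trans (Real.exp_le_exp.2 ?_)
  rw [Fintype.card_fin]
  linarith [mul_le_mul_of_nonneg_right h he₀]

theorem whp_numAllNegative_le (hk : 0 < k) (hm : ∀ n, (m n : ℝ) * (k / 2 ^ k) ≤ w * n)
    (hw : 0 < w) :
    WHP fun n (Φ : Formula k n (m n)) => (numAllNegative Φ : ℝ) ≤ 2 * (w / k) * n := by
  have hk' : (0 : ℝ) < k := Nat.cast_pos.2 hk
  refine whp_card_filter_le (P := fun n C => AllNegative C) (by positivity) ?_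
  filter_upwards [eventually_ne_atTop 0] with n hn
  have : NeZero n := ⟨hn⟩
  rw [prob_allNegative, div_mul_eq_mul_div, le_div_iff₀ hk']
  calc _ = (m n : ℝ) * (k / 2 ^ k) := by ring
    _ ≤ w * n := hm n

theorem whp_card_not_distinctVars_le (hm : ∀ n, (m n : ℝ) * (k / 2 ^ k) ≤ w * n) {δ : ℝ}
    (hδ : 0 < δ) :
    WHP fun n (Φ : Formula k n (m n)) =>
      ((Finset.univ.filter fun i => ¬ DistinctVars (Φ i)).card : ℝ) ≤ 2 * δ * n := by
  refine whp_card_filter_le (P := fun n C => ¬ DistinctVars C) hδ ?_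
  filter_upwards [eventually_ne_atTop 0, eventually_ge_atTop ⌈w * 2 ^ k * k / δ⌉₊] with n hn hδn
  have : NeZero n := ⟨hn⟩
  calc m n * prob {C : Clause k n | ¬ DistinctVars C} ≤ m n * (k ^ 2 / n) := by
        gcongr
        exact prob_not_distinctVars_le
    _ = m n * (k / 2 ^ k) * (2 ^ k * k / n) := by field_simp
    _ ≤ w * n * (2 ^ k * k / n) := mul_le_mul_of_nonneg_right (hm n) (by positivity)
    _ = w * 2 ^ k * k := by field_simp
    _ ≤ δ * n := (div_le_iff₀' hδ).1 (Nat.ceil_le.1 hδn)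

theorem whp_numUniqueAt_le (hm : ∀ n, (m n : ℝ) * (k / 2 ^ k) ≤ w * n) :
    WHP fun n (Φ : Formula k n (m n)) => ∀ Z x, (numUniqueAt Φ Z x : ℝ) ≤ √n := by
  refine .of_le (tendsto_natCast_mul_exp_sub_sqrt (w * 2 ^ k / 2 * (Real.exp 1 - 1))) ?_
  filter_upwards [eventually_ne_atTop 0] with n hn
  have : NeZero n := ⟨hn⟩
  have hdeg : ∀ (Φ : Formula k n (m n)) Z x, numUniqueAt Φ Z x ≤
      (Finset.univ.filter fun i => ∃ j, Φ i j = (x, true)).card := fun Φ Z x =>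
    Finset.card_le_card <| Finset.monotone_filter_right _ fun i _ hi => hi.2.imp fun j => And.left
  have hx : ∀ x : Fin n, prob {Φ : Formula k n (m n) |
      √n < (Finset.univ.filter fun i => ∃ j, Φ i j = (x, true)).card} ≤
        Real.exp (w * 2 ^ k / 2 * (Real.exp 1 - 1) - √n) := fun x => by
    refine (chernoff_card_filter (fun C : Clause k n => ∃ j, C j = (x, true)) zero_le_one
      _).trans (Real.exp_le_exp.2 ?_)
    rw [Fintype.card_fin, one_mul]
    have he : 0 ≤ Real.exp 1 - 1 := by linarith [Real.add_one_le_exp (1 : ℝ)]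
    gcongr
    calc m n * prob {C : Clause k n | ∃ j, C j = (x, true)} ≤ m n * (k / 2 / n) := by
          gcongr
          exact prob_occurs_le x
      _ = m n * (k / 2 ^ k) * (2 ^ k / 2 / n) := by field_simp
      _ ≤ w * n * (2 ^ k / 2 / n) := mul_le_mul_of_nonneg_right (hm n) (by positivity)
      _ = w * 2 ^ k / 2 := by field_simp
  push Not
  refine (prob_le_sum Finset.univ _ fun Φ hΦ => ?_).trans (Finset.sum_le_sum fun x _ => hx x)
    |>.trans_eq (by simp)
  obtain ⟨Z, x, hΦ⟩ := hΦ
  exact ⟨x, Finset.mem_univ x, hΦ.trans_le (Nat.cast_le.2 (hdeg Φ Z x))⟩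

end Events

section PhaseOne

variable {k : ℕ} {m : ℕ → ℕ} {w τ K σ δ a : ℝ}

theorem whp_card_phase1_le (hk : 0 < k) (hτ : 0 ≤ τ)
    (hneg : WHP fun n (Φ : Formula k n (m n)) => (numAllNegative Φ : ℝ) ≤ a * n)
    (h : a * (2 * Real.exp (-(k * τ / 2))) - τ / 2 < 0) :
    WHP fun n (Φ : Formula k n (m n)) => ((phase1 Φ).card : ℝ) ≤ τ * n := by
  have hlim := (tendsto_exp_natCast_mul h).const_mul (Real.exp 1)
  rw [mul_zero] at hlim
  refine hneg.of_resample (fun n => by positivity) hlim ?_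
  filter_upwards [eventually_ne_atTop 0] with n hn Φ hΦ
  have : NeZero n := ⟨hn⟩
  have hn' : (0 : ℝ) < n := Nat.cast_pos.2 hn.bot_lt
  have hceil := Nat.ceil_lt_add_one (show 0 ≤ τ * n / 2 by positivity)
  simp only [not_le]
  refine (prob_lt_card_phase1_resample_le hk Φ ⌈τ * n / 2⌉₊ (τ * n)).trans ?_
  rw [← Real.exp_add]
  refine Real.exp_le_exp.2 ?_
  have hdrift : Real.exp (-(k * ⌈τ * n / 2⌉₊ / n)) ≤ Real.exp (-(k * τ / 2)) := by
    refine Real.exp_le_exp.2 (neg_le_neg ?_)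
    rw [le_div_iff₀ hn']
    calc k * τ / 2 * n = k * (τ * n / 2) := by ring
      _ ≤ k * ⌈τ * n / 2⌉₊ := by gcongr; exact Nat.le_ceil _
  have : numAllNegative Φ * (2 * Real.exp (-(k * ⌈τ * n / 2⌉₊ / n))) ≤
      a * n * (2 * Real.exp (-(k * τ / 2))) :=
    mul_le_mul hΦ (by linarith) (by positivity) ((Nat.cast_nonneg _).trans hΦ)
  linarith

theorem whp_numMixedUnsat_phase1_le (hk : 0 < k) (hK : 0 ≤ K)
    (hsafe : WHP fun n (Φ : Formula k n (m n)) => ∀ Z : Finset (Fin n), (Z.card : ℝ) ≤ τ * n →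
      σ * n ≤ (Finset.univ.filter (ZSafe Φ Z)).card)
    (huniq : WHP fun n (Φ : Formula k n (m n)) =>
      ∀ Z : Finset (Fin n), (Z.card : ℝ) ≤ τ * n → (numZUnique Φ Z : ℝ) ≤ K * n)
    (hdeg : WHP fun n (Φ : Formula k n (m n)) => ∀ Z x, (numUniqueAt Φ Z x : ℝ) ≤ √n)
    (hneg : WHP fun n (Φ : Formula k n (m n)) => (numAllNegative Φ : ℝ) ≤ a * n)
    (h : a * (Real.exp (-((k₁ k - 1 : ℕ) * σ)) * (2 * K)) - δ < 0) :
    WHP fun n (Φ : Formula k n (m n)) => ((phase1 Φ).card : ℝ) ≤ τ * n →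
      (numMixedUnsat Φ (phase1 Φ) : ℝ) ≤ δ * n := by
  refine ((hsafe.and huniq).and (hdeg.and hneg)).of_resample (fun n => (Real.exp_pos _).le)
    (tendsto_exp_sqrt_mul h) ?_
  filter_upwards [eventually_ne_atTop 0] with n hn Φ ⟨⟨hsafe, huniq⟩, hdeg, hneg⟩
  have : NeZero n := ⟨hn⟩
  have hn' : (0 : ℝ) < n := Nat.cast_pos.2 hn.bot_lt
  have hsqrt : √n * √n = n := Real.mul_self_sqrt hn'.le
  push Not
  simp only [numMixedUnsat_resample]
  refine (prob_lt_numMixedUnsat_phase1_resample_le hk Φ (l := (√n)⁻¹) (by positivity) hsafe huniq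
    (fun Z x => (inv_mul_le_one₀ (by positivity)).2 (hdeg Z x)) (δ * n)).trans
    (Real.exp_le_exp.2 ?_)
  have hexponent : ((k₁ k - 1 : ℕ) : ℝ) * (σ * n) / n = (k₁ k - 1 : ℕ) * σ := by field_simp
  rw [hexponent]
  calc _ ≤ a * n * (Real.exp (-((k₁ k - 1 : ℕ) * σ)) * (2 * (√n)⁻¹ * (K * n) / n)) -
        (√n)⁻¹ * (δ * n) := by gcongr
    _ = √n * (a * (Real.exp (-((k₁ k - 1 : ℕ) * σ)) * (2 * K)) - δ) := by
        field_simp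
        linear_combination (δ - 2 * K * a * Real.exp (-((k₁ k - 1 : ℕ) * σ))) * hsqrt

theorem whp_phase1 (hk : 0 < k) (hm : ∀ n, (m n : ℝ) * (k / 2 ^ k) ≤ w * n) (hw : 0 < w)
    (hτ₀ : 0 ≤ τ) (hτ₁ : τ ≤ 1) (hK : 0 ≤ K) (hδ : 0 < δ) {y l : ℝ} (hy₀ : 0 < y) (hy₁ : y ≤ 1)
    (hl : 0 ≤ l) (huniq : y - τ * Real.log y + (w * (Real.exp l - 1) - l * K) < 0)
    (hsafe : y - τ * Real.log y + (σ - Real.exp (-(w + 1)) * (1 - τ) / 2) < 0)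
    (hsize : 2 * (w / k) * (2 * Real.exp (-(k * τ / 2))) - τ / 2 < 0)
    (hunsat : 2 * (w / k) * (Real.exp (-((k₁ k - 1 : ℕ) * σ)) * (2 * K)) - δ / 2 < 0) :
    WHP fun n (Φ : Formula k n (m n)) => ((phase1 Φ).card : ℝ) ≤ τ * n ∧
      (numZUnique Φ (phase1 Φ) : ℝ) ≤ K * n ∧
      (numUnsat Φ (sigma (phase1 Φ)) : ℝ) ≤ δ * n := by
  have hneg := whp_numAllNegative_le hk hm hw
  have hunique := whp_numZUnique_le hm hy₀ hy₁ hl huniq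
  have hmixed := whp_numMixedUnsat_phase1_le hk hK (whp_le_card_zSafe hm hw hτ₁ hy₀ hy₁ hsafe)
    hunique (whp_numUniqueAt_le hm) hneg hunsat
  have hrepeated := whp_card_not_distinctVars_le hm (δ := δ / 4) (by positivity)
  refine ((whp_card_phase1_le hk hτ₀ hneg hsize).and (hunique.and (hmixed.and hrepeated))).mono
    fun n Φ ⟨hcard, huniq, hmixed, hrepeated⟩ => ⟨hcard, huniq _ hcard, ?_⟩
  calc (numUnsat Φ (sigma (phase1 Φ)) : ℝ)
      ≤ numMixedUnsat Φ (phase1 Φ) + (Finset.univ.filter fun i => ¬ DistinctVars (Φ i)).card := by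
        exact_mod_cast numUnsat_phase1_le hk Φ
    _ ≤ δ / 2 * n + 2 * (δ / 4) * n := add_le_add (hmixed hcard) hrepeated
    _ = δ * n := by ring

end PhaseOne

section LargeClauses

open Asymptotics

variable {ε : ℝ}

/-- The bound `4 k⁻¹ ln ω` on `|Z| / n`. -/
noncomputable def zDensity (ε : ℝ) (k : ℕ) : ℝ := 4 / k * Real.log (omega ε k)

theorem cast_mul_le_omega_mul {k n m : ℕ} (hk : 0 < k) (hε₁ : ε ≤ 1)
    (hm : m ≤ numClauses ε k n) : (m : ℝ) * (k / 2 ^ k) ≤ omega ε k * n := by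
  have : (0 : ℝ) < k := Nat.cast_pos.2 hk
  have hnonneg : 0 ≤ (1 - ε) * 2 ^ k * (k : ℝ)⁻¹ * Real.log k * n := by
    have := sub_nonneg.2 hε₁
    positivity
  calc (m : ℝ) * (k / 2 ^ k)
      ≤ (1 - ε) * 2 ^ k * (k : ℝ)⁻¹ * Real.log k * n * (k / 2 ^ k) := by
        gcongr
        exact (Nat.cast_le.2 hm).trans (Nat.floor_le hnonneg)
    _ = omega ε k * n := by
        rw [omega]
        field_simp

theorem tendsto_omega (hε₁ : ε < 1) : Tendsto (fun k : ℕ => omega ε k) atTop atTop :=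
  (Real.tendsto_log_atTop.comp tendsto_natCast_atTop_atTop).const_mul_atTop (sub_pos.2 hε₁)

theorem omega_le_log (hε₀ : 0 ≤ ε) (k : ℕ) : omega ε k ≤ Real.log k :=
  mul_le_of_le_one_left (Real.log_natCast_nonneg k) (by linarith)

theorem exp_neg_omega {k : ℕ} (hk : 0 < k) : Real.exp (-omega ε k) = (k : ℝ) ^ (-1 + ε) := by
  rw [Real.rpow_def_of_pos (Nat.cast_pos.2 hk), omega]
  ring_nf

theorem isLittleO_natCast_rpow {r s : ℝ} (h : r < s) :
    (fun k : ℕ => (k : ℝ) ^ r) =o[atTop] fun k => (k : ℝ) ^ s := by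
  have hquot : (fun k : ℕ => (k : ℝ) ^ r / (k : ℝ) ^ s) =ᶠ[atTop]
      fun k => (k : ℝ) ^ (-(s - r)) := by
    filter_upwards [eventually_gt_atTop 0] with k hk
    rw [neg_sub, Real.rpow_sub (Nat.cast_pos.2 hk)]
  refine isLittleO_of_tendsto' ?_ (Tendsto.congr' hquot.symm
    ((tendsto_rpow_neg_atTop (sub_pos.2 h)).comp tendsto_natCast_atTop_atTop))
  filter_upwards [eventually_gt_atTop 0] with k hk h0
  exact absurd h0 (Real.rpow_pos_of_pos (Nat.cast_pos.2 hk) s).ne'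

theorem isLittleO_log_sq_natCast_rpow {r : ℝ} (hr : 0 < r) :
    (fun k : ℕ => Real.log k ^ 2) =o[atTop] fun k => (k : ℝ) ^ r := by
  simpa [Function.comp_def] using
    (isLittleO_log_rpow_rpow_atTop 2 hr).comp_tendsto tendsto_natCast_atTop_atTop

theorem log_omega_le_log {k : ℕ} (hε₀ : 0 ≤ ε) (h : 0 ≤ omega ε k) :
    Real.log (omega ε k) ≤ Real.log k :=
  (Real.log_le_self h).trans (omega_le_log hε₀ k)

theorem isLittleO_entropy (hε₀ : 0 ≤ ε) (hε₁ : ε < 1) {r : ℝ} (hr : 0 < r) :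
    (fun k : ℕ => (k : ℝ)⁻¹ - zDensity ε k * Real.log (k : ℝ)⁻¹) =o[atTop]
      fun k => (k : ℝ) ^ (-1 + r) := by
  have hone : (fun _ : ℕ => (1 : ℝ)) =o[atTop] fun k => (k : ℝ) ^ r := by
    simpa using isLittleO_natCast_rpow hr
  have hlog := hone.add ((isLittleO_log_sq_natCast_rpow hr).const_mul_left 4)
  have hinv := (isBigO_refl (fun k : ℕ => (k : ℝ)⁻¹) atTop).mul_isLittleO hlog
  refine IsBigO.trans_isLittleO (.of_bound' ?_) (hinv.congr' .rfl ?_)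
  · filter_upwards [(tendsto_omega hε₁).eventually_ge_atTop 1] with k hω
    have hle := log_omega_le_log hε₀ (zero_le_one.trans hω)
    have hpos := Real.log_nonneg hω
    have heq : (k : ℝ)⁻¹ - zDensity ε k * Real.log (k : ℝ)⁻¹ =
        (k : ℝ)⁻¹ * (1 + 4 * (Real.log (omega ε k) * Real.log k)) := by
      rw [zDensity, Real.log_inv]
      ring
    rw [heq, Real.norm_of_nonneg (by positivity), Real.norm_of_nonneg (by positivity), sq]
    gcongr
  · filter_upwards [eventually_gt_atTop 0] with k hk
    rw [Real.rpow_add (Nat.cast_pos.2 hk), Real.rpow_neg_one]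

theorem eventually_zDensity_mem_Icc (hε₀ : 0 ≤ ε) (hε₁ : ε < 1) :
    ∀ᶠ k : ℕ in atTop, zDensity ε k ∈ Set.Icc 0 (1 / 2) := by
  have hlog := (Real.tendsto_log_atTop.comp tendsto_natCast_atTop_atTop).eventually_ge_atTop 1
  filter_upwards [(tendsto_omega hε₁).eventually_ge_atTop 1, hlog, eventually_gt_atTop 0,
    (isLittleO_entropy hε₀ hε₁ one_pos).bound one_half_pos] with k hω hlogk hk hent
  have hτ : 0 ≤ zDensity ε k := mul_nonneg (by positivity) (Real.log_nonneg hω)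
  refine ⟨hτ, ?_⟩
  have hinv : 0 < (k : ℝ)⁻¹ := inv_pos.2 (Nat.cast_pos.2 hk)
  have hmul := mul_le_mul_of_nonneg_left hlogk hτ
  rw [Real.log_inv] at hent
  have := (le_abs_self _).trans hent
  simp only [neg_add_cancel, Real.rpow_zero, norm_one, Function.comp_apply] at this hmul
  linarith

theorem eventually_unique_exponent_neg (hε₀ : 0 < ε) (hε₁ : ε < 1) :
    ∀ᶠ k : ℕ in atTop, (k : ℝ)⁻¹ - zDensity ε k * Real.log (k : ℝ)⁻¹ +
      (omega ε k * (Real.exp (ε / 6) - 1) - ε / 6 * ((1 + ε / 3) * omega ε k)) < 0 := by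
  have hexp : Real.exp (ε / 6) - 1 - ε / 6 ≤ (ε / 6) ^ 2 :=
    (le_abs_self _).trans (Real.abs_exp_sub_one_sub_id_le (by
      rw [abs_of_pos (by positivity)]
      linarith))
  filter_upwards [(tendsto_omega hε₁).eventually_ge_atTop 1,
    (isLittleO_entropy hε₀.le hε₁ one_pos).bound (show 0 < ε ^ 2 / 72 by positivity)]
    with k hω hent
  have hent := (le_abs_self _).trans hent
  simp only [neg_add_cancel, Real.rpow_zero, norm_one] at hent
  have hexp := mul_le_mul_of_nonneg_left hexp (zero_le_one.trans hω)
  have hω := mul_le_mul_of_nonneg_left hω (sq_nonneg ε)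
  nlinarith [sq_pos_of_pos hε₀]

theorem eventually_safe_exponent_neg (hε₀ : 0 < ε) (hε₁ : ε < 1) :
    ∀ᶠ k : ℕ in atTop, (k : ℝ)⁻¹ - zDensity ε k * Real.log (k : ℝ)⁻¹ +
      ((k : ℝ) ^ (-1 + ε / 2) - Real.exp (-(omega ε k + 1)) * (1 - zDensity ε k) / 2) < 0 := by
  have hlittle := (isLittleO_entropy hε₀.le hε₁ hε₀).add
    (isLittleO_natCast_rpow (show -1 + ε / 2 < -1 + ε by linarith))
  filter_upwards [eventually_zDensity_mem_Icc hε₀.le hε₁, eventually_gt_atTop 0,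
    hlittle.bound (show (0 : ℝ) < 1 / 13 by norm_num)] with k hτ hk hbound
  have hpow : 0 < (k : ℝ) ^ (-1 + ε) := Real.rpow_pos_of_pos (Nat.cast_pos.2 hk) _
  have hlow : (k : ℝ) ^ (-1 + ε) / 12 ≤ Real.exp (-(omega ε k + 1)) * (1 - zDensity ε k) / 2 := by
    rw [neg_add, Real.exp_add, exp_neg_omega hk]
    have he : (1 : ℝ) / 3 ≤ Real.exp (-1) := by linarith [Real.exp_neg_one_gt_d9]
    calc (k : ℝ) ^ (-1 + ε) / 12 = (k : ℝ) ^ (-1 + ε) * (1 / 3) * (1 / 2) / 2 := by ring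
      _ ≤ _ := by
        gcongr
        linarith [hτ.2]
  rw [Real.norm_of_nonneg hpow.le] at hbound
  linarith [(le_abs_self _).trans hbound]

theorem eventually_size_drift_neg (hε₁ : ε < 1) :
    ∀ᶠ k : ℕ in atTop, 2 * (omega ε k / k) * (2 * Real.exp (-(k * zDensity ε k / 2))) -
      zDensity ε k / 2 < 0 := by
  filter_upwards [(tendsto_omega hε₁).eventually_ge_atTop 3, eventually_gt_atTop 0] with k hω hk
  have : (0 : ℝ) < k := Nat.cast_pos.2 hk
  have hω₀ : 0 < omega ε k := by linarith
  have hlog : 1 ≤ Real.log (omega ε k) := by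
    rw [Real.le_log_iff_exp_le hω₀]
    linarith [Real.exp_one_lt_d9]
  have hexp : Real.exp (-(k * zDensity ε k / 2)) = (omega ε k ^ 2)⁻¹ := by
    rw [← Real.exp_log (pow_pos hω₀ 2), ← Real.exp_neg, Real.log_pow, zDensity]
    congr 1
    push_cast
    field_simp
    ring
  have hmul : 2 < omega ε k * Real.log (omega ε k) := by nlinarith
  calc _ = 2 / (k * omega ε k) * (2 - omega ε k * Real.log (omega ε k)) := by
        rw [hexp, zDensity]
        field_simp
        ring
    _ < 0 := mul_neg_of_pos_of_neg (by positivity) (by linarith)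

theorem eventually_unsat_drift_neg (hε₀ : 0 < ε) (hε₁ : ε < 1) :
    ∀ᶠ k : ℕ in atTop, 2 * (omega ε k / k) *
      (Real.exp (-((k₁ k - 1 : ℕ) * (k : ℝ) ^ (-1 + ε / 2))) * (2 * ((1 + ε / 3) * omega ε k))) -
        Real.exp (-(k : ℝ) ^ (ε / 8)) / 2 < 0 := by
  filter_upwards [(tendsto_omega hε₁).eventually_ge_atTop 0, eventually_ge_atTop 4,
    (isLittleO_natCast_rpow (show ε / 8 < ε / 2 by linarith)).bound
      (show (0 : ℝ) < 1 / 5 by norm_num),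
    (isLittleO_log_sq_natCast_rpow one_pos).bound (show (0 : ℝ) < 1 / 16 by norm_num)]
    with k hω hk hpow hlog
  have hk' : (0 : ℝ) < k := by positivity
  have hpos : 0 < (k : ℝ) ^ (ε / 2) := Real.rpow_pos_of_pos hk' _
  rw [Real.norm_of_nonneg (by positivity), Real.norm_of_nonneg (by positivity)] at hpow hlog
  rw [Real.rpow_one] at hlog
  have hk₁ : (k : ℝ) / 4 ≤ (k₁ k - 1 : ℕ) := by
    have : k ≤ 4 * (k₁ k - 1) := by
      unfold k₁
      omega
    rw [div_le_iff₀' (by norm_num)]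
    exact_mod_cast this
  have hexp : Real.exp (-((k₁ k - 1 : ℕ) * (k : ℝ) ^ (-1 + ε / 2))) <
      Real.exp (-(k : ℝ) ^ (ε / 8)) := by
    refine Real.exp_lt_exp.2 (neg_lt_neg ?_)
    calc (k : ℝ) ^ (ε / 8) < k / 4 * (k : ℝ) ^ (-1 + ε / 2) := by
          rw [Real.rpow_add hk', Real.rpow_neg_one]
          field_simp
          linarith
      _ ≤ _ := by gcongr
  have hsq : 8 * (1 + ε / 3) * omega ε k ^ 2 ≤ k := by
    have hω₂ : omega ε k ^ 2 ≤ Real.log k ^ 2 := by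
      gcongr
      exact omega_le_log hε₀.le k
    nlinarith [sq_nonneg (omega ε k)]
  calc _ = 8 * (1 + ε / 3) * omega ε k ^ 2 / k / 2 *
          Real.exp (-((k₁ k - 1 : ℕ) * (k : ℝ) ^ (-1 + ε / 2))) -
            Real.exp (-(k : ℝ) ^ (ε / 8)) / 2 := by ring
    _ ≤ 1 / 2 * Real.exp (-((k₁ k - 1 : ℕ) * (k : ℝ) ^ (-1 + ε / 2))) -
            Real.exp (-(k : ℝ) ^ (ε / 8)) / 2 := by
        gcongr
        exact div_le_one_of_le₀ hsq hk'.le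
    _ < 0 := by linarith

end LargeClauses

end RandomKSAT

theorem proposition3p1_general (ε : ℝ) (hε₀ : 0 < ε) (hε₁ : ε < 1) :
    ∃ k₀ : ℕ, ∀ k : ℕ, k₀ ≤ k → ∀ m : ℕ → ℕ, (∀ n, m n ≤ RandomKSAT.numClauses ε k n) →
      Tendsto
        (fun n : ℕ =>
          RandomKSAT.uniformFormula k n (m n)
            {Φ : RandomKSAT.Formula k n (m n) |
              ((RandomKSAT.phase1 Φ).card : ℝ)
                  ≤ 4 * n * (k : ℝ)⁻¹ * Real.log (RandomKSAT.omega ε k) ∧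
              (RandomKSAT.numZUnique Φ (RandomKSAT.phase1 Φ) : ℝ)
                  ≤ (1 + ε / 3) * RandomKSAT.omega ε k * n ∧
              (RandomKSAT.numUnsat Φ (RandomKSAT.sigma (RandomKSAT.phase1 Φ)) : ℝ)
                  ≤ Real.exp (-(k : ℝ) ^ (ε / 8)) * n})
        atTop (𝓝 1) := by
  obtain ⟨k₀, hk₀⟩ := eventually_atTop.1 <|
    (eventually_gt_atTop 0).and <|
    ((RandomKSAT.tendsto_omega hε₁).eventually_gt_atTop 0).and <|
    (RandomKSAT.eventually_zDensity_mem_Icc hε₀.le hε₁).and <|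
    (RandomKSAT.eventually_unique_exponent_neg hε₀ hε₁).and <|
    (RandomKSAT.eventually_safe_exponent_neg hε₀ hε₁).and <|
    (RandomKSAT.eventually_size_drift_neg hε₁).and <|
    RandomKSAT.eventually_unsat_drift_neg hε₀ hε₁
  refine ⟨k₀, fun k hk m hm => ?_⟩
  obtain ⟨hk, hω, hτ, huniq, hsafe, hsize, hunsat⟩ := hk₀ k hk
  have hsize_eq : ∀ n : ℕ, 4 * n * (k : ℝ)⁻¹ * Real.log (RandomKSAT.omega ε k) =
      RandomKSAT.zDensity ε k * n := fun n => by
    rw [RandomKSAT.zDensity]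
    ring
  simp only [hsize_eq]
  exact (RandomKSAT.whp_phase1 hk (fun n => RandomKSAT.cast_mul_le_omega_mul hk hε₁.le (hm n)) hω
    hτ.1 (hτ.2.trans one_half_lt_one.le) (by positivity) (Real.exp_pos _) (by positivity)
    (Nat.cast_inv_le_one k) (by positivity) huniq hsafe hsize hunsat).tendsto_uniformFormula

theorem proposition3p1 (ε : ℝ) (hε₀ : 0 < ε) (hε₁ : ε < 0.1) :
    ∃ k₀ : ℕ, ∀ k : ℕ, k₀ ≤ k →
      Tendsto
        (fun n : ℕ =>
          RandomKSAT.uniformFormula k n (RandomKSAT.numClauses ε k n)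
            {Φ : RandomKSAT.Formula k n (RandomKSAT.numClauses ε k n) |
              ((RandomKSAT.phase1 Φ).card : ℝ)
                  ≤ 4 * n * (k : ℝ)⁻¹ * Real.log (RandomKSAT.omega ε k) ∧
              (RandomKSAT.numZUnique Φ (RandomKSAT.phase1 Φ) : ℝ)
                  ≤ (1 + ε / 3) * RandomKSAT.omega ε k * n ∧
              (RandomKSAT.numUnsat Φ (RandomKSAT.sigma (RandomKSAT.phase1 Φ)) : ℝ)
                  ≤ Real.exp (-(k : ℝ) ^ (ε / 8)) * n})
        atTop (𝓝 1) := by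
  obtain ⟨k₀, hk₀⟩ := proposition3p1_general ε hε₀ (hε₁.trans (by norm_num))
  exact ⟨k₀, fun k hk => hk₀ k hk _ fun _ => le_rfl⟩
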